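/- Let $K$ be a field, $n\ge 2$ an integer and $p=n-1$. Let $m_0<m_1<\dots<m_p$ be an arithmetic sequence of positive integers and $m_n$ a positive integer such that $\gcd(m_0,\dots,m_n)=1$ and $m_0,\dots,m_n$ minimally generate the semigroup $\Gamma=\sum_{i=0}^n\mathbb N_0m_i$ (no $m_i$ lies in the semigroup generated by the others). Put $\Gamma'=\sum_{i=0}^p\mathbb N_0m_i$ and $S=\{\gamma\in\Gamma : \gamma-m_0\notin\Gamma\}$. Let $P$ be the kernel of the $K$-algebra homomorphism $K[x_0,\dots,x_n]\to K[t]$, $x_i\mapsto t^{m_i}$. For an integer $t\ge 0$ let $q_t\in\mathbb Z$ and $r_t\in\{1,\dots,p\}$ be given by $t=q_tp+r_t$, and put $g_t=q_tm_p+m_{r_t}$. There are unique integers $u,\upsilon,w,z,\lambda,\mu,\nu$ such that $u=\min\{t\ge0 : g_t\notin S\}$, $\upsilon=\min\{b\ge1 : bm_n\in\Gamma'\}$, $0\le w\le\upsilon-1$, $0\le z\le u-1$, $\lambda\ge1$, $\mu\ge0$, $\nu\ge2$, $$g_u=\lambda m_0+wm_n,\qquad \upsilon m_n=\mu m_0+g_z,\qquad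 g_{u-z}+(\upsilon-w)m_n=\nu m_0,$$ and $\nu=\lambda+\mu+1$ if $r_{u-z}<r_u$, $\nu=\lambda+\mu$ if $r_{u-z}\ge r_u$. Write $q=q_u$, $r=r_u$, $q'=q_{u-z}$, $r'=r_{u-z}$, and $W=[u-z,u-1]\times[\upsilon-w,\upsilon-1]$ (a product of integer intervals). Let $J=\emptyset$ if $W=\emptyset$, and $J=\{j\in\mathbb Z : 0\le j\le\min(z-1,p-r')\}$ otherwise. Define $$\varphi_i=x_{r+i}x_p^{q}-x_0^{\lambda-1}x_ix_n^{w},\qquad \psi_j=x_{r'+j}x_p^{q'}x_n^{\upsilon-w}-x_0^{\nu-1}x_j,\qquad \theta=x_n^{\upsilon}-x_0^{\mu}x_{r_z}x_p^{q_z}$$ (for $z=0$ one has $r_z=p$, $q_z=-1$, and $x_{r_z}x_p^{q_z}$ means $1$), and $$\xi_{i,j}=\begin{cases}x_ix_j-x_0x_{i+j}&\text{if } i+j\le p,\\ x_ix_j-x_{i+j-p}x_p&\text{if } i+j>p.\end{cases}$$ Order monomials by the weighted graded reverse lexicographic order with $x_0<x_1<\dots<x_n$ and $\mathrm{wt}(x_i)=m_i$: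 $x^a>x^b$ if and only if $\sum_i a_im_i>\sum_i b_im_i$, or these sums are equal and the left-most nonzero entry of $(a_0-b_0,\dots,a_n-b_n)$ is negative. Then the set $$\Phi=\{\varphi_i : 0\le i\le p-r\}\cup\{\psi_j : j\in J\}\cup\{\theta\}\cup\{\xi_{i,j} : 1\le i\le j\le p-1\}$$ is a minimal Gröbner basis of $P$ with respect to this order: $\Phi$ is a finite subset of $P$ whose leading terms generate the ideal generated by the leading terms of all elements of $P$; every $f\in\Phi$ has leading coefficient $1$; and for every $f\in\Phi$ the leading monomial of $f$ is not in the ideal generated by the leading monomials of the elements of $\Phi\setminus\{f\}$. -/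

import Mathlib

/-!
Throughout, the integer `n ≥ 2` is written `n = p + 1` with `p ≥ 1`; the variables
`x_0, …, x_p, x_n` and the integers `m_0, …, m_p, m_n` are indexed by `Fin (p + 2)`.
-/

namespace AlmostArith

/-! ### The weighted graded reverse lexicographic order -/

section Order

variable {N : ℕ}

/-- The weighted degree `∑ i, a_i * m_i` of an exponent vector. -/
def wt (m : Fin N → ℕ) (a : Fin N →₀ ℕ) : ℕ := ∑ i, a i * m i

/-- Exponent vectors, to be ordered by the weighted grevlex order. -/
def WExp (_m : Fin N → ℕ) : Type := Fin N →₀ ℕ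

/-- The identity map from exponent vectors to `WExp m`. -/
def toWExp (m : Fin N → ℕ) : (Fin N →₀ ℕ) ≃ WExp m := Equiv.refl _

noncomputable instance (m : Fin N → ℕ) : AddCommMonoid (WExp m) :=
  inferInstanceAs (AddCommMonoid (Fin N →₀ ℕ))

/-- Sort key: first the weighted degree, then the negated exponents `(-a_0, -a_1, …)`
lexicographically from the left. -/
def wKey (m : Fin N → ℕ) (a : Fin N →₀ ℕ) : ℕ ×ₗ Lex (Fin N → ℤ) :=
  toLex (wt m a, toLex fun i => -(a i : ℤ))

theorem wKey_injective (m : Fin N → ℕ) : Function.Injective (wKey m) := by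
  intro a b h
  have h2 : (fun i => -(a i : ℤ)) = fun i => -(b i : ℤ) :=
    toLex.injective (Prod.ext_iff.1 (toLex.injective h)).2
  ext i
  have := congrFun h2 i
  simpa using this

noncomputable instance (m : Fin N → ℕ) : LinearOrder (WExp m) :=
  LinearOrder.lift' (fun a : WExp m => wKey m ((toWExp m).symm a))
    ((wKey_injective m).comp (toWExp m).symm.injective)

theorem wKey_lt_iff (m : Fin N → ℕ) (a b : Fin N →₀ ℕ) :
    wKey m a < wKey m b ↔ wt m a < wt m b ∨
      wt m a = wt m b ∧ ∃ i, (∀ j < i, a j = b j) ∧ b i < a i := by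
  rw [wKey, wKey, Prod.Lex.toLex_lt_toLex]
  refine or_congr Iff.rfl (and_congr Iff.rfl ?_)
  constructor
  · rintro ⟨i, h1, h2⟩
    exact ⟨i, fun j hj => by simpa using h1 j hj, by simpa using h2⟩
  · rintro ⟨i, h1, h2⟩
    exact ⟨i, fun j hj => by simpa using h1 j hj, by simpa using h2⟩

theorem wt_add (m : Fin N → ℕ) (a b : Fin N →₀ ℕ) : wt m (a + b) = wt m a + wt m b := by
  simp [wt, add_mul, Finset.sum_add_distrib]

theorem toWExp_lt_iff (m : Fin N → ℕ) (a b : Fin N →₀ ℕ) :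
    toWExp m a < toWExp m b ↔ wt m a < wt m b ∨
      wt m a = wt m b ∧ ∃ i, (∀ j < i, a j = b j) ∧ b i < a i :=
  wKey_lt_iff m a b

instance (m : Fin N → ℕ) : IsOrderedAddMonoid (WExp m) where
  add_le_add_left a b h c := by
    rcases h.lt_or_eq with h | rfl
    · refine le_of_lt ?_
      change toWExp m ((toWExp m).symm a + (toWExp m).symm c) <
        toWExp m ((toWExp m).symm b + (toWExp m).symm c)
      have h' : toWExp m ((toWExp m).symm a) < toWExp m ((toWExp m).symm b) := h
      rw [toWExp_lt_iff] at h' ⊢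
      simpa [wt_add] using h'
    · exact le_rfl

theorem toWExp_monotone (m : Fin N → ℕ) (hm : ∀ i, 0 < m i) : Monotone (toWExp m) := by
  intro a b h
  obtain ⟨c, rfl⟩ := exists_add_of_le h
  by_cases hc : c = 0
  · simp [hc]
  · refine le_of_lt ?_
    rw [toWExp_lt_iff, wt_add]
    left
    obtain ⟨i, hi⟩ := Finsupp.ne_iff.1 hc
    have h1 : 0 < c i * m i := Nat.mul_pos (Nat.pos_of_ne_zero hi) (hm i)
    have h2 : c i * m i ≤ wt m c :=
      Finset.single_le_sum (f := fun i => c i * m i) (fun _ _ => Nat.zero_le _)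
        (Finset.mem_univ i)
    omega

/-- The graded reverse lexicographic order with `x_0 < x_1 < …` and grading `wt(x_i) = m_i`:
`x^a > x^b` iff `x^a` has the larger weighted degree, or the weighted degrees agree and the
left-most nonzero entry of `(a_0 - b_0, a_1 - b_1, …)` is negative. -/
noncomputable def wGrevlex (m : Fin N → ℕ) (hm : ∀ i, 0 < m i) : MonomialOrder (Fin N) where
  syn := WExp m
  toSyn := { toWExp m with map_add' := fun _ _ => rfl }
  toSyn_monotone := toWExp_monotone m hm
  wellFoundedLT_syn := by
    have : WellQuasiOrderedLE (WExp m) :=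
      (toWExp_monotone m hm).wellQuasiOrderedLE_of_wellQuasiOrderedLE_of_surjective
        (toWExp m).surjective
    infer_instance

theorem wGrevlex_lt_iff (m : Fin N → ℕ) (hm : ∀ i, 0 < m i) (a b : Fin N →₀ ℕ) :
    (wGrevlex m hm).toSyn a < (wGrevlex m hm).toSyn b ↔ wt m a < wt m b ∨
      wt m a = wt m b ∧ ∃ i, (∀ j < i, a j = b j) ∧ b i < a i :=
  toWExp_lt_iff m a b

end Order

/-! ### Minimal Gröbner bases -/

section Groebner

variable {σ K : Type*} [Field K]

/-- `G` is a Gröbner basis of the ideal `I`: a finite subset of `I` whose leading terms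
generate the ideal of all leading terms of elements of `I`. -/
def IsGroebnerBasis (ord : MonomialOrder σ) (I : Ideal (MvPolynomial σ K))
    (G : Set (MvPolynomial σ K)) : Prop :=
  G.Finite ∧ G ⊆ I ∧
    Ideal.span (ord.leadingTerm '' G) = Ideal.span (ord.leadingTerm '' (I : Set _))

/-- The leading monomial (with coefficient one); used for nonzero polynomials only. -/
noncomputable def leadingMonomial (ord : MonomialOrder σ) (f : MvPolynomial σ K) :
    MvPolynomial σ K :=
  MvPolynomial.monomial (ord.degree f) 1

/-- A minimal Gröbner basis: every leading coefficient is one, and no leading monomial lies in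
the ideal generated by the leading monomials of the other elements. -/
def IsMinimalGroebnerBasis (ord : MonomialOrder σ) (I : Ideal (MvPolynomial σ K))
    (G : Set (MvPolynomial σ K)) : Prop :=
  IsGroebnerBasis ord I G ∧
  (∀ f ∈ G, ord.leadingCoeff f = 1) ∧
  ∀ f ∈ G, leadingMonomial ord f ∉ Ideal.span (leadingMonomial ord '' (G \ {f}))

end Groebner

/-! ### The monomial curve -/

/-- The defining ideal of the monomial curve `x_i = t ^ m_i`. -/
noncomputable def curveIdeal (K : Type*) [Field K] {N : ℕ} (m : Fin N → ℕ) :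
    Ideal (MvPolynomial (Fin N) K) :=
  RingHom.ker (MvPolynomial.aeval (fun i => (Polynomial.X : Polynomial K) ^ m i) :
    MvPolynomial (Fin N) K →ₐ[K] Polynomial K)

section Parameters

variable {p : ℕ}

/-- The index `i` as an element of `{0, …, p + 1}`; only used for `i ≤ p + 1`. -/
def ix (p i : ℕ) : Fin (p + 2) := Fin.ofNat (p + 2) i

/-- The standing assumptions: `m_0 < ⋯ < m_p` is an arithmetic sequence of positive integers,
`m_n = m_{p+1}` is an arbitrary positive integer, the `m_i` have gcd one, and they minimally
generate their semigroup. -/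
structure IsAlmostArith (m : Fin (p + 2) → ℕ) : Prop where
  one_le_p : 1 ≤ p
  pos : ∀ i, 0 < m i
  arith : ∃ d : ℕ, 0 < d ∧ ∀ i ≤ p, m (ix p i) = m (ix p 0) + i * d
  gcd_eq_one : Finset.univ.gcd m = 1
  minimal : ∀ i, m i ∉ AddSubmonoid.closure (m '' {i}ᶜ)

/-- The semigroup `Γ` generated by all the `m_i`, inside `ℤ`. -/
def Gam (m : Fin (p + 2) → ℕ) : AddSubmonoid ℤ :=
  AddSubmonoid.closure (Set.range fun i => (m i : ℤ))

/-- The semigroup `Γ'` generated by `m_0, …, m_p`. -/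
def Gam' (m : Fin (p + 2) → ℕ) : AddSubmonoid ℤ :=
  AddSubmonoid.closure {x | ∃ i ≤ p, x = (m (ix p i) : ℤ)}

/-- `S = {γ ∈ Γ | γ - m_0 ∉ Γ}`. -/
def setS (m : Fin (p + 2) → ℕ) : Set ℤ :=
  {γ | γ ∈ Gam m ∧ γ - (m (ix p 0) : ℤ) ∉ Gam m}

/-- The integer `q_t` with `t = q_t * p + r_t`, `1 ≤ r_t ≤ p`; note `q_0 = -1`. -/
def qt (p t : ℕ) : ℤ := ((t : ℤ) - 1) / p

/-- The integer `r_t ∈ [1, p]` with `t = q_t * p + r_t`; note `r_0 = p`. -/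
def rt (p t : ℕ) : ℕ := (((t : ℤ) - 1) % p).toNat + 1

theorem qt_rt_spec (p t : ℕ) (hp : 1 ≤ p) :
    (t : ℤ) = qt p t * p + rt p t ∧ 1 ≤ rt p t ∧ rt p t ≤ p := by
  have hp' : (0 : ℤ) < p := by exact_mod_cast hp
  have h1 := Int.emod_nonneg ((t : ℤ) - 1) hp'.ne'
  have h2 := Int.emod_lt_of_pos ((t : ℤ) - 1) hp'
  have h3 := Int.ediv_mul_add_emod ((t : ℤ) - 1) p
  refine ⟨?_, ?_, ?_⟩
  · unfold qt rt
    push_cast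
    rw [Int.toNat_of_nonneg h1]
    linarith
  · unfold rt
    omega
  · unfold rt
    omega

/-- `g_t = q_t * m_p + m_{r_t}`. -/
def gSeq (m : Fin (p + 2) → ℕ) (t : ℕ) : ℤ :=
  qt p t * (m (ix p p) : ℤ) + (m (ix p (rt p t)) : ℤ)

/-- A tuple of values for the parameters `u, υ, w, z, λ, μ, ν`. -/
structure Params where
  u : ℕ
  v : ℕ
  w : ℕ
  z : ℕ
  lam : ℕ
  mu : ℕ
  nu : ℕ

/-- The conditions that determine the parameters attached to `m`:
`u = min {t ≥ 0 | g_t ∉ S}`, `υ = min {b ≥ 1 | b m_n ∈ Γ'}`, `w ∈ [0, υ-1]`, `z ∈ [0, u-1]`,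
`λ ≥ 1`, `μ ≥ 0`, `ν ≥ 2`, `g_u = λ m_0 + w m_n`, `υ m_n = μ m_0 + g_z` and
`g_{u-z} + (υ-w) m_n = ν m_0`, where `ν` is `λ+μ+1` or `λ+μ` according to whether
`r_{u-z} < r_u` or not. -/
structure IsParams (m : Fin (p + 2) → ℕ) (c : Params) : Prop where
  u_least : IsLeast {t : ℕ | gSeq m t ∉ setS m} c.u
  v_least : IsLeast {b : ℕ | 1 ≤ b ∧ (b : ℤ) * (m (ix p (p + 1)) : ℤ) ∈ Gam' m} c.v
  w_lt : c.w < c.v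
  z_lt : c.z < c.u
  one_le_lam : 1 ≤ c.lam
  two_le_nu : 2 ≤ c.nu
  eq_u : gSeq m c.u = c.lam * (m (ix p 0) : ℤ) + c.w * (m (ix p (p + 1)) : ℤ)
  eq_v : (c.v : ℤ) * (m (ix p (p + 1)) : ℤ) = c.mu * (m (ix p 0) : ℤ) + gSeq m c.z
  eq_uz : gSeq m (c.u - c.z) + ((c.v : ℤ) - c.w) * (m (ix p (p + 1)) : ℤ) =
    c.nu * (m (ix p 0) : ℤ)
  nu_eq : c.nu = if rt p (c.u - c.z) < rt p c.u then c.lam + c.mu + 1 else c.lam + c.mu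

end Parameters

/-! ### The binomials

All natural-number subtractions and conversions below are harmless when `IsParams m c` holds:
`z < u`, `w < υ`, `λ ≥ 1`, `ν ≥ 2`, `q_u ≥ 0` and `q_{u-z} ≥ 0`. -/

section Binomials

variable (K : Type*) [Field K] (p : ℕ) (c : Params)

/-- The variable `x_i`, `0 ≤ i ≤ p + 1`; the last one, `x_{p+1}`, is `x_n`. -/
noncomputable def x (i : ℕ) : MvPolynomial (Fin (p + 2)) K := MvPolynomial.X (ix p i)

/-- `q = q_u`. -/
def q : ℕ := (qt p c.u).toNat

/-- `r = r_u`. -/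
def r : ℕ := rt p c.u

/-- `q' = q_{u-z}`. -/
def q' : ℕ := (qt p (c.u - c.z)).toNat

/-- `r' = r_{u-z}`. -/
def r' : ℕ := rt p (c.u - c.z)

/-- `W = [u-z, u-1] × [υ-w, υ-1]`. -/
def W : Finset (ℕ × ℕ) :=
  Finset.Icc (c.u - c.z) (c.u - 1) ×ˢ Finset.Icc (c.v - c.w) (c.v - 1)

/-- The index set `J`: empty if `W` is empty, and `[0, min (z-1) (p-r')]` otherwise. -/
def J : Finset ℕ :=
  if W c = ∅ then ∅ else Finset.Icc 0 (min (c.z - 1) (p - r' p c))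

/-- `φ_i = x_{r+i} x_p^q - x_0^{λ-1} x_i x_n^w`. -/
noncomputable def phi (i : ℕ) : MvPolynomial (Fin (p + 2)) K :=
  x K p (r p c + i) * x K p p ^ q p c - x K p 0 ^ (c.lam - 1) * x K p i * x K p (p + 1) ^ c.w

/-- `ψ_j = x_{r'+j} x_p^{q'} x_n^{υ-w} - x_0^{ν-1} x_j`. -/
noncomputable def psi (j : ℕ) : MvPolynomial (Fin (p + 2)) K :=
  x K p (r' p c + j) * x K p p ^ q' p c * x K p (p + 1) ^ (c.v - c.w) -
    x K p 0 ^ (c.nu - 1) * x K p j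

/-- The monomial `x_{r_t} x_p^{q_t}`; for `t = 0` it is `x_p * x_p^{-1} = 1`. -/
noncomputable def gMon (t : ℕ) : MvPolynomial (Fin (p + 2)) K :=
  if t = 0 then 1 else x K p (rt p t) * x K p p ^ (qt p t).toNat

/-- `θ = x_n^υ - x_0^μ x_{r_z} x_p^{q_z}`. -/
noncomputable def theta : MvPolynomial (Fin (p + 2)) K :=
  x K p (p + 1) ^ c.v - x K p 0 ^ c.mu * gMon K p c.z

/-- `ξ_{i,j} = x_i x_j - x_0 x_{i+j}` if `i + j ≤ p`, and `x_i x_j - x_{i+j-p} x_p` otherwise. -/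
noncomputable def xi (i j : ℕ) : MvPolynomial (Fin (p + 2)) K :=
  if i + j ≤ p then x K p i * x K p j - x K p 0 * x K p (i + j)
  else x K p i * x K p j - x K p (i + j - p) * x K p p

/-- The set `Φ`. -/
def Phi : Set (MvPolynomial (Fin (p + 2)) K) :=
  {f | ∃ i, i ≤ p - r p c ∧ f = phi K p c i} ∪
  {f | ∃ j ∈ J p c, f = psi K p c j} ∪
  {theta K p c} ∪
  {f | ∃ i j, 1 ≤ i ∧ i ≤ j ∧ j ≤ p - 1 ∧ f = xi K p i j}

end Binomials

end AlmostArith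

/-!
Monomials are ordered so that, within a weight, more `x_0` means smaller; the standard monomial of a
weight `γ` is thus the one that is lexicographically largest in its exponents.

*The numbers.* Since `g_t = ⌈t / p⌉ m_0 + t d`, where `d` is the common difference, the sequence `g`
is additive up to `0` or `1` times `m_0` (`IsAlmostArith.gSeq_add`). Hence `Γ'` is the set of all
`a m_0 + g_s`, and `Γ` the set of all `a m_0 + g_s + b m_n`. Subtracting `g_s` from a relation for
`g_u` shows that `g_u` is a combination of `m_0` and `m_n` only; together with a relation for
`υ m_n` whose index `z` is least, this gives the parameters, and minimality of `u` and `υ` gives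
their uniqueness. The same two minimality properties show that the numbers `g_s + b m_n` with
`(s, b)` in the box `[0, u-1] × [0, υ-1]` outside `W` are pairwise incongruent modulo `m_0`
(`IsParams.pair_unique`).

*The ideal.* The leading monomials of `Φ` are the `x_i x_j` with `1 ≤ i ≤ j ≤ p - 1`, the monomials
of weight `g_{u+i}`, if `W` is nonempty those of weight `g_{u-z+j}` times `x_n^(υ-w)`, and `x_n^υ`.
The monomials that
none of them divides are `x_0^a x_{r_s} x_p^{q_s} x_n^b` with `(s, b)` in the box outside `W`
(`exists_normal_form_box`), so they have distinct weights (`normal_form_unique`). Every monomial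
reduces by `Φ` to such a monomial of the same weight. If the leading monomial of some `f ∈ P` were
one of them, another monomial of `f` of the same weight would reduce to a smaller one, which is
impossible; so `Φ` is a Gröbner basis (`isMinimalGroebnerBasis_binomial`). Because the `m_i` are
minimal generators, `u > p`, so `x_p` occurs in the leading monomial of every `φ_i`, and the leading
monomials form an antichain (`PhiPairs_antichain`).
-/

namespace AlmostArith

/-! ### Binomial Gröbner bases of the defining ideal of a monomial curve -/

section Binomial

variable {N : ℕ} {K : Type*} [Field K]

/-- The binomial `x^a - x^b` attached to a pair of exponent vectors. -/
noncomputable def binomial (K : Type*) [Field K] {N : ℕ} (d : (Fin N →₀ ℕ) × (Fin N →₀ ℕ)) :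
    MvPolynomial (Fin N) K :=
  MvPolynomial.monomial d.1 1 - MvPolynomial.monomial d.2 1

theorem degree_binomial (ord : MonomialOrder (Fin N)) {d : (Fin N →₀ ℕ) × (Fin N →₀ ℕ)}
    (h : ord.toSyn d.2 < ord.toSyn d.1) : ord.degree (binomial K d) = d.1 := by
  classical
  rw [binomial, ord.degree_sub_of_lt] <;> simp [ord.degree_monomial, h]

theorem leadingCoeff_binomial (ord : MonomialOrder (Fin N)) {d : (Fin N →₀ ℕ) × (Fin N →₀ ℕ)}
    (h : ord.toSyn d.2 < ord.toSyn d.1) : ord.leadingCoeff (binomial K d) = 1 := by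
  classical
  rw [binomial, ord.leadingCoeff_sub_of_lt] <;> simp [ord.degree_monomial, h]

theorem leadingMonomial_binomial (ord : MonomialOrder (Fin N))
    {d : (Fin N →₀ ℕ) × (Fin N →₀ ℕ)} (h : ord.toSyn d.2 < ord.toSyn d.1) :
    leadingMonomial ord (binomial K d) = MvPolynomial.monomial d.1 1 := by
  rw [leadingMonomial, degree_binomial ord h]

theorem leadingTerm_binomial (ord : MonomialOrder (Fin N))
    {d : (Fin N →₀ ℕ) × (Fin N →₀ ℕ)} (h : ord.toSyn d.2 < ord.toSyn d.1) :
    ord.leadingTerm (binomial K d) = MvPolynomial.monomial d.1 1 := by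
  rw [MonomialOrder.leadingTerm, degree_binomial ord h, leadingCoeff_binomial ord h]

theorem aeval_monomial_curve (m : Fin N → ℕ) (a : Fin N →₀ ℕ) (k : K) :
    MvPolynomial.aeval (fun i => (Polynomial.X : Polynomial K) ^ m i)
      (MvPolynomial.monomial a k) = Polynomial.monomial (wt m a) k := by
  rw [MvPolynomial.aeval_monomial, Finsupp.prod_fintype _ _ (by simp)]
  simp only [← pow_mul, Finset.prod_pow_eq_pow_sum, mul_comm (m _) _]
  rw [Polynomial.algebraMap_eq, Polynomial.C_mul_X_pow_eq_monomial, wt]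

theorem binomial_mem_curveIdeal {m : Fin N → ℕ} {d : (Fin N →₀ ℕ) × (Fin N →₀ ℕ)}
    (h : wt m d.1 = wt m d.2) : binomial K d ∈ curveIdeal K m := by
  rw [curveIdeal, RingHom.mem_ker, binomial, map_sub]
  erw [aeval_monomial_curve, aeval_monomial_curve]
  rw [h, sub_self]

/-- The ideal of the curve is homogeneous for the weight and has no monomials, so the terms of
an element cancel against each other within each weight. -/
theorem exists_mem_support_wt_eq {m : Fin N → ℕ} {f : MvPolynomial (Fin N) K}
    (hf : f ∈ curveIdeal K m) {a : Fin N →₀ ℕ} (ha : a ∈ f.support) :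
    ∃ b ∈ f.support, b ≠ a ∧ wt m b = wt m a := by
  by_contra! hcon
  have h0 : MvPolynomial.aeval (fun i => (Polynomial.X : Polynomial K) ^ m i) f = 0 := hf
  rw [f.as_sum, map_sum] at h0
  simp only [aeval_monomial_curve] at h0
  have h1 := congrArg (fun g => Polynomial.coeff g (wt m a)) h0
  simp only [Polynomial.finsetSum_coeff, Polynomial.coeff_monomial, Polynomial.coeff_zero] at h1
  rw [Finset.sum_eq_single a] at h1
  · rw [if_pos rfl] at h1
    exact (MvPolynomial.mem_support_iff.1 ha) h1
  · intro b hb hba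
    rw [if_neg (hcon b hb hba)]
  · exact fun h => absurd ha h

/-- Replacing `x^a` by `x^b` in a multiple of `x^a` keeps the weight and lowers the monomial;
iterating this ends in a monomial that no `x^a` divides. -/
theorem exists_reduced {m : Fin N → ℕ} (hm : ∀ i, 0 < m i)
    {D : Set ((Fin N →₀ ℕ) × (Fin N →₀ ℕ))}
    (hwt : ∀ d ∈ D, wt m d.1 = wt m d.2)
    (hlt : ∀ d ∈ D, (wGrevlex m hm).toSyn d.2 < (wGrevlex m hm).toSyn d.1)
    (a : Fin N →₀ ℕ) :
    ∃ b, (∀ d ∈ D, ¬ d.1 ≤ b) ∧ wt m b = wt m a ∧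
      (wGrevlex m hm).toSyn b ≤ (wGrevlex m hm).toSyn a := by
  have wf : WellFounded fun x y => (wGrevlex m hm).toSyn x < (wGrevlex m hm).toSyn y :=
    InvImage.wf _ wellFounded_lt
  induction a using wf.induction with
  | _ a ih =>
    by_cases h : ∃ d ∈ D, d.1 ≤ a
    · obtain ⟨d, hd, hda⟩ := h
      obtain ⟨c, rfl⟩ := exists_add_of_le hda
      have h1 : (wGrevlex m hm).toSyn (d.2 + c) < (wGrevlex m hm).toSyn (d.1 + c) := by
        rw [map_add, map_add]
        exact add_lt_add_left (hlt d hd) _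
      obtain ⟨b, hb, hbw, hbl⟩ := ih _ h1
      refine ⟨b, hb, ?_, hbl.trans h1.le⟩
      rw [hbw, wt_add, wt_add, hwt d hd]
    · push Not at h
      exact ⟨a, h, rfl, le_rfl⟩

/-- A finite set of weight-homogeneous binomials is a minimal Gröbner basis of the ideal of the
curve as soon as the monomials outside the initial ideal it generates have distinct weights and
the leading monomials form an antichain. -/
theorem isMinimalGroebnerBasis_binomial {m : Fin N → ℕ} (hm : ∀ i, 0 < m i)
    {D : Set ((Fin N →₀ ℕ) × (Fin N →₀ ℕ))} (hfin : D.Finite)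
    (hwt : ∀ d ∈ D, wt m d.1 = wt m d.2)
    (hlt : ∀ d ∈ D, (wGrevlex m hm).toSyn d.2 < (wGrevlex m hm).toSyn d.1)
    (hinj : ∀ a b, (∀ d ∈ D, ¬ d.1 ≤ a) → (∀ d ∈ D, ¬ d.1 ≤ b) → wt m a = wt m b → a = b)
    (hanti : ∀ d ∈ D, ∀ d' ∈ D, d.1 ≤ d'.1 → d = d') :
    IsMinimalGroebnerBasis (wGrevlex m hm) (curveIdeal K m) (binomial K '' D) := by
  have himage : (wGrevlex m hm).leadingTerm '' (binomial K '' D) =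
      (fun s => MvPolynomial.monomial s (1 : K)) '' (Prod.fst '' D) := by
    rw [Set.image_image, Set.image_image]
    exact Set.image_congr fun d hd => leadingTerm_binomial _ (hlt d hd)
  have hsub : binomial K '' D ⊆ curveIdeal K m := by
    rintro _ ⟨d, hd, rfl⟩
    exact binomial_mem_curveIdeal (hwt d hd)
  refine ⟨⟨hfin.image _, hsub, ?_⟩, ?_, ?_⟩
  · refine le_antisymm (Ideal.span_mono (Set.image_mono hsub)) (Ideal.span_le.2 ?_)
    rintro _ ⟨f, hf, rfl⟩
    rw [himage, SetLike.mem_coe, MvPolynomial.mem_ideal_span_monomial_image]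
    intro a ha
    have hf0 : f ≠ 0 := by
      rintro rfl
      simp at ha
    have ha' : a = (wGrevlex m hm).degree f := by
      have := MvPolynomial.support_monomial_subset ha
      simpa using this
    by_contra! hred
    have hmem : a ∈ f.support := ha' ▸ (wGrevlex m hm).degree_mem_support hf0
    obtain ⟨b, hb, hba, hbw⟩ := exists_mem_support_wt_eq hf hmem
    obtain ⟨b', hb', hbw', hle⟩ := exists_reduced hm hwt hlt b
    have h1 : b' = a := hinj b' a hb' (fun d hd => hred d.1 ⟨d, hd, rfl⟩) (hbw'.trans hbw)
    have h2 : (wGrevlex m hm).toSyn b ≤ (wGrevlex m hm).toSyn a :=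
      ha' ▸ (wGrevlex m hm).le_degree hb
    rw [h1] at hle
    exact hba ((wGrevlex m hm).toSyn.injective (le_antisymm h2 hle))
  · rintro _ ⟨d, hd, rfl⟩
    exact leadingCoeff_binomial _ (hlt d hd)
  · rintro _ ⟨d, hd, rfl⟩ hmem
    have h1 : leadingMonomial (wGrevlex m hm) '' (binomial K '' D \ {binomial K d}) ⊆
        (fun s => MvPolynomial.monomial s (1 : K)) '' (Prod.fst '' (D \ {d})) := by
      rintro _ ⟨_, ⟨⟨e, he, rfl⟩, hne⟩, rfl⟩
      refine ⟨e.1, ⟨e, ⟨he, ?_⟩, rfl⟩, (leadingMonomial_binomial _ (hlt e he)).symm⟩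
      rintro rfl
      exact hne rfl
    have h2 := Ideal.span_mono h1 hmem
    rw [MvPolynomial.mem_ideal_span_monomial_image, leadingMonomial_binomial _ (hlt d hd)] at h2
    obtain ⟨_, ⟨e, ⟨he, hne⟩, rfl⟩, hle⟩ := h2 d.1 (by simp)
    exact hne (hanti e he d hd hle)

end Binomial

/-! ### The sequence `g_t` -/

section Semigroup

variable {p : ℕ} {m : Fin (p + 2) → ℕ}

theorem qt_zero (hp : 1 ≤ p) : qt p 0 = -1 := by
  obtain ⟨h1, h2, h3⟩ := qt_rt_spec p 0 hp
  have : (1 : ℤ) ≤ p := by exact_mod_cast hp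
  push_cast at h1
  nlinarith

theorem rt_zero (hp : 1 ≤ p) : rt p 0 = p := by
  obtain ⟨h1, -, -⟩ := qt_rt_spec p 0 hp
  rw [qt_zero hp] at h1
  push_cast at h1
  omega

theorem qt_nonneg (hp : 1 ≤ p) {t : ℕ} (ht : 1 ≤ t) : 0 ≤ qt p t := by
  unfold qt
  exact Int.ediv_nonneg (by omega) (by omega)

theorem qt_mono (hp : 1 ≤ p) {s t : ℕ} (hst : s ≤ t) : qt p s ≤ qt p t := by
  unfold qt
  exact Int.ediv_le_ediv (by omega) (by omega)

/-- `t = q_t p + r_t` with `1 ≤ r_t ≤ p` determines `q_t` and `r_t`. -/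
theorem qt_rt_unique {t b i : ℕ} (h : t = b * p + i) (h1 : 1 ≤ i) (h2 : i ≤ p) :
    qt p t = b ∧ rt p t = i := by
  have hq : qt p t = b := by
    obtain ⟨h3, h4, h5⟩ := qt_rt_spec p t (h1.trans h2)
    have e : (t : ℤ) = b * p + i := by exact_mod_cast h
    have hp : (0 : ℤ) < p := by omega
    have l1 : qt p t < b + 1 := by
      by_contra hc
      nlinarith
    have l2 : (b : ℤ) < qt p t + 1 := by
      by_contra hc
      nlinarith
    omega
  refine ⟨hq, ?_⟩
  obtain ⟨h3, -, -⟩ := qt_rt_spec p t (h1.trans h2)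
  have e : (t : ℤ) = b * p + i := by exact_mod_cast h
  rw [hq] at h3
  omega

/-- The defect of additivity of `t ↦ q_t + 1 = ⌈t / p⌉`. -/
def defect (p s t : ℕ) : ℤ := qt p s + qt p t + 1 - qt p (s + t)

theorem defect_eq (hp : 1 ≤ p) (s t : ℕ) :
    defect p s t = if rt p s < rt p (s + t) then 1 else 0 := by
  obtain ⟨h1, h2, h3⟩ := qt_rt_spec p s hp
  obtain ⟨h4, h5, h6⟩ := qt_rt_spec p t hp
  obtain ⟨h7, h8, h9⟩ := qt_rt_spec p (s + t) hp
  have hp' : (0 : ℤ) < p := by omega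
  have e : (1 - defect p s t) * p = rt p s + rt p t - rt p (s + t) := by
    push_cast at h7
    unfold defect
    linear_combination h1 + h4 - h7
  have l1 : defect p s t < 2 := by
    by_contra hc
    nlinarith
  have l2 : -1 < defect p s t := by
    by_contra hc
    nlinarith
  split_ifs with h
  · by_contra hc
    have : defect p s t = 0 := by omega
    rw [this] at e
    omega
  · by_contra hc
    have : defect p s t = 1 := by omega
    rw [this] at e
    omega

theorem defect_cases (hp : 1 ≤ p) (s t : ℕ) : defect p s t = 0 ∨ defect p s t = 1 := by
  rw [defect_eq hp]
  split_ifs <;> simp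

theorem ix_val {i : ℕ} (hi : i ≤ p + 1) : (ix p i).val = i := by
  simp only [ix, Fin.ofNat]
  exact Nat.mod_eq_of_lt (by omega)

theorem ix_inj {i j : ℕ} (hi : i ≤ p + 1) (hj : j ≤ p + 1) : ix p i = ix p j ↔ i = j := by
  rw [← Fin.val_inj, ix_val hi, ix_val hj]

theorem exists_ix (k : Fin (p + 2)) : ∃ i ≤ p + 1, k = ix p i := by
  refine ⟨k.val, by omega, ?_⟩
  rw [← Fin.val_inj, ix_val (by omega)]

theorem IsAlmostArith.gSeq_eq (hm : IsAlmostArith m) : ∃ d : ℕ, 0 < d ∧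
    (∀ i ≤ p, m (ix p i) = m (ix p 0) + i * d) ∧
    ∀ t, gSeq m t = (qt p t + 1) * m (ix p 0) + t * d := by
  obtain ⟨d, hd, h⟩ := hm.arith
  refine ⟨d, hd, h, fun t => ?_⟩
  obtain ⟨h1, h2, h3⟩ := qt_rt_spec p t hm.one_le_p
  rw [gSeq, h p le_rfl, h _ h3, h1]
  push_cast
  ring

/-- `g` is additive up to a multiple `0` or `1` of `m_0`. -/
theorem IsAlmostArith.gSeq_add (hm : IsAlmostArith m) (s t : ℕ) :
    gSeq m s + gSeq m t = gSeq m (s + t) + defect p s t * m (ix p 0) := by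
  obtain ⟨d, -, -, h⟩ := hm.gSeq_eq
  rw [h, h, h, defect]
  push_cast
  ring

theorem IsAlmostArith.gSeq_lt (hm : IsAlmostArith m) {s t : ℕ} (hst : s < t) :
    gSeq m s < gSeq m t := by
  obtain ⟨d, hd, -, h⟩ := hm.gSeq_eq
  rw [h, h]
  have h1 : qt p s ≤ qt p t := qt_mono hm.one_le_p hst.le
  have h2 : (s : ℤ) < t := by exact_mod_cast hst
  have h3 : (0 : ℤ) < d := by exact_mod_cast hd
  have h4 : (0 : ℤ) ≤ m (ix p 0) := by positivity
  nlinarith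

theorem IsAlmostArith.gSeq_zero (hm : IsAlmostArith m) : gSeq m 0 = 0 := by
  rw [gSeq, qt_zero hm.one_le_p, rt_zero hm.one_le_p]
  ring

theorem IsAlmostArith.gSeq_nonneg (hm : IsAlmostArith m) (t : ℕ) : 0 ≤ gSeq m t := by
  rcases Nat.eq_zero_or_pos t with rfl | ht
  · rw [hm.gSeq_zero]
  · have := hm.gSeq_lt ht
    rw [hm.gSeq_zero] at this
    exact this.le

theorem IsAlmostArith.gSeq_of_le (_hm : IsAlmostArith m) {t : ℕ} (h1 : 1 ≤ t) (h2 : t ≤ p) :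
    gSeq m t = m (ix p t) := by
  obtain ⟨hq, hr⟩ := qt_rt_unique (p := p) (t := t) (b := 0) (i := t) (by omega) h1 h2
  rw [gSeq, hq, hr]
  simp

theorem IsAlmostArith.pos_int (hm : IsAlmostArith m) (i : ℕ) : (0 : ℤ) < m (ix p i) := by
  exact_mod_cast hm.pos _

/-! ### The semigroups `Γ'` and `Γ` -/

theorem gen_mem_Gam' {i : ℕ} (hi : i ≤ p) : (m (ix p i) : ℤ) ∈ Gam' m :=
  AddSubmonoid.subset_closure ⟨i, hi, rfl⟩

theorem gen_mem_Gam (k : Fin (p + 2)) : (m k : ℤ) ∈ Gam m :=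
  AddSubmonoid.subset_closure ⟨k, rfl⟩

theorem gSeq_mem_Gam' (hm : IsAlmostArith m) (t : ℕ) : gSeq m t ∈ Gam' m := by
  rcases Nat.eq_zero_or_pos t with rfl | ht
  · rw [hm.gSeq_zero]
    exact zero_mem _
  · obtain ⟨k, hk⟩ := Int.eq_ofNat_of_zero_le (qt_nonneg hm.one_le_p ht)
    rw [gSeq, hk, ← nsmul_eq_mul]
    exact add_mem (nsmul_mem (gen_mem_Gam' le_rfl) _)
      (gen_mem_Gam' (qt_rt_spec p t hm.one_le_p).2.2)

/-- Every element of `Γ'` is `a m_0 + g_s`: these elements include the generators and are closed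
under addition, `g` being additive up to a multiple of `m_0`. -/
theorem mem_Gam'_iff (hm : IsAlmostArith m) {γ : ℤ} :
    γ ∈ Gam' m ↔ ∃ a s : ℕ, γ = a * (m (ix p 0) : ℤ) + gSeq m s := by
  constructor
  · intro h
    induction h using AddSubmonoid.closure_induction with
    | mem x hx =>
      obtain ⟨i, hi, rfl⟩ := hx
      rcases Nat.eq_zero_or_pos i with rfl | h0
      · exact ⟨1, 0, by rw [hm.gSeq_zero]; push_cast; ring⟩
      · exact ⟨0, i, by rw [hm.gSeq_of_le h0 hi]; push_cast; ring⟩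
    | zero => exact ⟨0, 0, by rw [hm.gSeq_zero]; simp⟩
    | add x y _ _ hx hy =>
      obtain ⟨a, s, rfl⟩ := hx
      obtain ⟨b, t, rfl⟩ := hy
      have h := hm.gSeq_add s t
      rcases defect_cases hm.one_le_p s t with h0 | h0 <;> rw [h0] at h
      · exact ⟨a + b, s + t, by push_cast; linear_combination h⟩
      · exact ⟨a + b + 1, s + t, by push_cast; linear_combination h⟩
  · rintro ⟨a, s, rfl⟩
    rw [← nsmul_eq_mul]
    exact add_mem (nsmul_mem (gen_mem_Gam' (Nat.zero_le _)) _) (gSeq_mem_Gam' hm s)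

theorem Gam'_le_Gam : Gam' m ≤ Gam m := by
  refine AddSubmonoid.closure_mono ?_
  rintro _ ⟨i, -, rfl⟩
  exact ⟨_, rfl⟩

theorem mem_Gam_iff (hm : IsAlmostArith m) {γ : ℤ} :
    γ ∈ Gam m ↔ ∃ a s b : ℕ,
      γ = a * (m (ix p 0) : ℤ) + gSeq m s + b * (m (ix p (p + 1)) : ℤ) := by
  constructor
  · intro h
    have h' : γ ∈ Gam' m ⊔ AddSubmonoid.closure {(m (ix p (p + 1)) : ℤ)} := by
      refine (AddSubmonoid.closure_le.2 ?_) h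
      rintro _ ⟨k, rfl⟩
      obtain ⟨i, hi, rfl⟩ := exists_ix k
      rcases Nat.lt_or_ge p i with h0 | h0
      · obtain rfl : i = p + 1 := by omega
        exact AddSubmonoid.mem_sup_right (AddSubmonoid.subset_closure rfl)
      · exact AddSubmonoid.mem_sup_left (AddSubmonoid.subset_closure ⟨i, h0, rfl⟩)
    obtain ⟨y, hy, z, hz, rfl⟩ := AddSubmonoid.mem_sup.1 h'
    obtain ⟨a, s, rfl⟩ := (mem_Gam'_iff hm).1 hy
    obtain ⟨b, rfl⟩ := AddSubmonoid.mem_closure_singleton.1 hz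
    exact ⟨a, s, b, by rw [nsmul_eq_mul]⟩
  · rintro ⟨a, s, b, rfl⟩
    refine add_mem (Gam'_le_Gam ((mem_Gam'_iff hm).2 ⟨a, s, rfl⟩)) ?_
    rw [← nsmul_eq_mul]
    exact nsmul_mem (gen_mem_Gam _) _

theorem gSeq_notMem_setS_iff (hm : IsAlmostArith m) {t : ℕ} :
    gSeq m t ∉ setS m ↔ ∃ a s b : ℕ, gSeq m t =
      (a + 1) * (m (ix p 0) : ℤ) + gSeq m s + b * (m (ix p (p + 1)) : ℤ) := by
  have h1 : gSeq m t ∈ Gam m := Gam'_le_Gam (gSeq_mem_Gam' hm t)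
  have h2 : gSeq m t ∉ setS m ↔ gSeq m t - (m (ix p 0) : ℤ) ∈ Gam m := by
    simp [setS, h1]
  rw [h2, mem_Gam_iff hm]
  refine exists_congr fun a => exists_congr fun s => exists_congr fun b => ?_
  constructor <;> intro h <;> linear_combination h

/-! ### Existence and uniqueness of the parameters -/

theorem exists_gSeq_notMem_setS (hm : IsAlmostArith m) : ∃ t, gSeq m t ∉ setS m := by
  -- For `t = m_0 p` one has `g_t = m_0 m_p`, a positive multiple of `m_0`.
  have h0 : 0 < m (ix p 0) := hm.pos _
  have hp := hm.one_le_p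
  refine ⟨(m (ix p 0) - 1) * p + p, (gSeq_notMem_setS_iff hm).2 ⟨m (ix p p) - 1, 0, 0, ?_⟩⟩
  obtain ⟨hq, hr⟩ := qt_rt_unique (p := p) rfl hp le_rfl (b := m (ix p 0) - 1)
  have h1 : 1 ≤ m (ix p p) := hm.pos _
  rw [gSeq, hq, hr, hm.gSeq_zero]
  push_cast [Nat.cast_sub h0, Nat.cast_sub h1]
  ring

theorem exists_mul_mem_Gam' (hm : IsAlmostArith m) :
    ∃ b : ℕ, 1 ≤ b ∧ (b : ℤ) * (m (ix p (p + 1)) : ℤ) ∈ Gam' m :=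
  ⟨m (ix p 0), hm.pos _, (mem_Gam'_iff hm).2 ⟨m (ix p (p + 1)), 0, by
    rw [hm.gSeq_zero]; ring⟩⟩

/-- A representation `g_u = (a + 1) m_0 + g_s + b m_n` forces `s = 0`: otherwise subtracting `g_s`
would give such a representation of `g_{u-s}`. -/
theorem eq_zero_of_gSeq_eq (hm : IsAlmostArith m) {u : ℕ}
    (hu : IsLeast {t : ℕ | gSeq m t ∉ setS m} u) {a s b : ℕ}
    (h : gSeq m u =
      (a + 1) * (m (ix p 0) : ℤ) + gSeq m s + b * (m (ix p (p + 1)) : ℤ)) : s = 0 := by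
  by_contra hs
  have hm0 := hm.pos_int 0
  have hmn := hm.pos_int (p + 1)
  have hsu : s ≤ u := by
    by_contra hc
    have := hm.gSeq_lt (not_le.1 hc)
    have h1 : 0 ≤ (a + 1 : ℤ) * (m (ix p 0) : ℤ) := by positivity
    have h2 : 0 ≤ (b : ℤ) * (m (ix p (p + 1)) : ℤ) := by positivity
    linarith
  have hadd := hm.gSeq_add (u - s) s
  rw [Nat.sub_add_cancel hsu] at hadd
  have hmem : gSeq m (u - s) ∉ setS m := by
    rw [gSeq_notMem_setS_iff hm]
    rcases defect_cases hm.one_le_p (u - s) s with h0 | h0 <;> rw [h0] at hadd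
    · exact ⟨a, 0, b, by rw [hm.gSeq_zero]; linear_combination hadd + h⟩
    · exact ⟨a + 1, 0, b, by rw [hm.gSeq_zero]; push_cast; linear_combination hadd + h⟩
  have := hu.2 hmem
  omega

theorem least_u_pos (hm : IsAlmostArith m) {u : ℕ}
    (hu : IsLeast {t : ℕ | gSeq m t ∉ setS m} u) : 0 < u := by
  rcases Nat.eq_zero_or_pos u with rfl | h
  · obtain ⟨a, s, b, h⟩ := (gSeq_notMem_setS_iff hm).1 hu.1
    rw [hm.gSeq_zero] at h
    have hm0 := hm.pos_int 0
    have h1 : 0 < (a + 1 : ℤ) * (m (ix p 0) : ℤ) := by positivity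
    have h2 : 0 ≤ (b : ℤ) * (m (ix p (p + 1)) : ℤ) := by positivity
    have := hm.gSeq_nonneg s
    linarith
  · exact h

theorem exists_lam_w (hm : IsAlmostArith m) {u v : ℕ}
    (hu : IsLeast {t : ℕ | gSeq m t ∉ setS m} u)
    (hv : IsLeast {b : ℕ | 1 ≤ b ∧ (b : ℤ) * (m (ix p (p + 1)) : ℤ) ∈ Gam' m} v) :
    ∃ lam w : ℕ, 1 ≤ lam ∧ w < v ∧
      gSeq m u = lam * (m (ix p 0) : ℤ) + w * (m (ix p (p + 1)) : ℤ) := by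
  -- Take the representation of `g_u` with the least coefficient of `m_n`.
  have hex : ∃ b a s : ℕ, gSeq m u =
      (a + 1) * (m (ix p 0) : ℤ) + gSeq m s + b * (m (ix p (p + 1)) : ℤ) := by
    obtain ⟨a, s, b, h⟩ := (gSeq_notMem_setS_iff hm).1 hu.1
    exact ⟨b, a, s, h⟩
  classical
  obtain ⟨a, s, h⟩ := Nat.find_spec hex
  set b := Nat.find hex with hb
  obtain rfl := eq_zero_of_gSeq_eq hm hu h
  rw [hm.gSeq_zero] at h
  refine ⟨a + 1, b, by omega, ?_, by push_cast; linear_combination h⟩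
  by_contra hc
  have hvb : v ≤ b := not_lt.1 hc
  obtain ⟨hv1, hv2⟩ := hv.1
  obtain ⟨c, t, ht⟩ := (mem_Gam'_iff hm).1 hv2
  refine Nat.find_min hex (m := b - v) (by omega) ⟨a + c, t, ?_⟩
  push_cast [Nat.cast_sub hvb]
  linear_combination h + ht

theorem exists_mu_z (hm : IsAlmostArith m) {u v : ℕ}
    (hu : IsLeast {t : ℕ | gSeq m t ∉ setS m} u)
    (hv : IsLeast {b : ℕ | 1 ≤ b ∧ (b : ℤ) * (m (ix p (p + 1)) : ℤ) ∈ Gam' m} v) :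
    ∃ mu z : ℕ, z < u ∧
      (v : ℤ) * (m (ix p (p + 1)) : ℤ) = mu * (m (ix p 0) : ℤ) + gSeq m z := by
  -- Take the representation of `v m_n` with the least index `z`.
  have hex : ∃ z mu : ℕ,
      (v : ℤ) * (m (ix p (p + 1)) : ℤ) = mu * (m (ix p 0) : ℤ) + gSeq m z := by
    obtain ⟨a, s, h⟩ := (mem_Gam'_iff hm).1 hv.1.2
    exact ⟨s, a, h⟩
  classical
  obtain ⟨mu, h⟩ := Nat.find_spec hex
  set z := Nat.find hex with hz
  refine ⟨mu, z, ?_, h⟩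
  by_contra hc
  have huz : u ≤ z := not_lt.1 hc
  have hu0 := least_u_pos hm hu
  obtain ⟨lam, w, hlam, hw, he⟩ := exists_lam_w hm hu hv
  have hadd := hm.gSeq_add u (z - u)
  rw [Nat.add_sub_cancel' huz] at hadd
  -- Replacing `g_z` by `g_u + g_{z-u}` up to `m_0` writes `(v - w) m_n` in `Γ'`.
  have key : ∃ c : ℕ, ((v - w : ℕ) : ℤ) * (m (ix p (p + 1)) : ℤ) =
      c * (m (ix p 0) : ℤ) + gSeq m (z - u) := by
    rcases defect_cases hm.one_le_p u (z - u) with h0 | h0 <;> rw [h0] at hadd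
    · exact ⟨mu + lam, by push_cast [Nat.cast_sub hw.le]; linear_combination h + he - hadd⟩
    · exact ⟨mu + lam - 1, by
        push_cast [Nat.cast_sub hw.le, Nat.cast_sub (show 1 ≤ mu + lam by omega)]
        linear_combination h + he - hadd⟩
  obtain ⟨c, hcc⟩ := key
  rcases Nat.eq_zero_or_pos w with rfl | hw0
  · exact Nat.find_min hex (m := z - u) (by omega) ⟨c, hcc⟩
  · have := hv.2 (show v - w ∈ _ from ⟨by omega, (mem_Gam'_iff hm).2 ⟨c, z - u, hcc⟩⟩)
    omega

theorem exists_isParams (hm : IsAlmostArith m) : ∃ c : Params, IsParams m c := by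
  classical
  have hp := hm.one_le_p
  obtain ⟨u, hu⟩ : ∃ u, IsLeast {t : ℕ | gSeq m t ∉ setS m} u :=
    ⟨_, Nat.isLeast_find (exists_gSeq_notMem_setS hm)⟩
  obtain ⟨v, hv⟩ : ∃ v, IsLeast {b : ℕ | 1 ≤ b ∧
      (b : ℤ) * (m (ix p (p + 1)) : ℤ) ∈ Gam' m} v :=
    ⟨_, Nat.isLeast_find (exists_mul_mem_Gam' hm)⟩
  obtain ⟨lam, w, hlam, hw, he⟩ := exists_lam_w hm hu hv
  obtain ⟨mu, z, hz, hmu⟩ := exists_mu_z hm hu hv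
  have hadd := hm.gSeq_add (u - z) z
  rw [Nat.sub_add_cancel hz.le, defect_eq hp, Nat.sub_add_cancel hz.le] at hadd
  have huz : gSeq m (u - z) + ((v : ℤ) - w) * (m (ix p (p + 1)) : ℤ) =
      ((if rt p (u - z) < rt p u then lam + mu + 1 else lam + mu : ℕ) : ℤ) *
        (m (ix p 0) : ℤ) := by
    split_ifs at hadd ⊢
    · push_cast
      linear_combination hadd + he + hmu
    · push_cast
      linear_combination hadd + he + hmu
  refine ⟨⟨u, v, w, z, lam, mu,
    if rt p (u - z) < rt p u then lam + mu + 1 else lam + mu⟩,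
    ⟨hu, hv, hw, hz, hlam, ?_, he, hmu, huz, rfl⟩⟩
  -- The left side of `huz` is at least `m_1`, hence larger than `m_0`.
  change 2 ≤ if rt p (u - z) < rt p u then lam + mu + 1 else lam + mu
  generalize (if rt p (u - z) < rt p u then lam + mu + 1 else lam + mu) = nu at huz ⊢
  by_contra hc
  have hnu : (nu : ℤ) ≤ 1 := by omega
  have hm0 := hm.pos_int 0
  have hmn := hm.pos_int (p + 1)
  have hw' : (w : ℤ) < v := by exact_mod_cast hw
  obtain ⟨d, hd, -, hg⟩ := hm.gSeq_eq
  have h1 := qt_nonneg hp (show 1 ≤ u - z by omega)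
  have h2 : (0 : ℤ) < ((u - z : ℕ) : ℤ) * d := by
    have : 0 < u - z := by omega
    positivity
  rw [hg] at huz
  nlinarith

theorem IsParams.ext (hm : IsAlmostArith m) {c c' : Params} (h : IsParams m c)
    (h' : IsParams m c') : c = c' := by
  have hm0 := hm.pos_int 0
  have hmn := hm.pos_int (p + 1)
  have hu : c.u = c'.u := h.u_least.unique h'.u_least
  have hv : c.v = c'.v := h.v_least.unique h'.v_least
  -- The exponents `w`: a difference would give a multiple of `m_n` in `Γ'` below `v m_n`.
  have aux : ∀ {c c' : Params}, IsParams m c → IsParams m c' → c.u = c'.u → c.v = c'.v →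
      ¬ c.w < c'.w := by
    intro c c' h h' hu hv hlt
    have e := h.eq_u
    rw [hu, h'.eq_u] at e
    have hlt' : (c.w : ℤ) < c'.w := by exact_mod_cast hlt
    have hle : c'.lam ≤ c.lam := by
      by_contra hc
      have : (c.lam : ℤ) < c'.lam := by omega
      nlinarith
    have := h'.v_least.2 (show c'.w - c.w ∈ _ from ⟨by omega, (mem_Gam'_iff hm).2
      ⟨c.lam - c'.lam, 0, by
        rw [hm.gSeq_zero]
        push_cast [Nat.cast_sub hlt.le, Nat.cast_sub hle]
        linear_combination e⟩⟩)
    have := h'.w_lt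
    omega
  have hw : c.w = c'.w :=
    le_antisymm (not_lt.1 (aux h' h hu.symm hv.symm)) (not_lt.1 (aux h h' hu hv))
  have hlam : c.lam = c'.lam := by
    have e := h.eq_u
    rw [hu, h'.eq_u, hw] at e
    have : (c.lam : ℤ) * (m (ix p 0) : ℤ) = c'.lam * (m (ix p 0) : ℤ) := by linear_combination -e
    exact_mod_cast mul_right_cancel₀ hm0.ne' this
  -- A difference between the exponents `μ` would show that `g_z` is not in `S`, although `z < u`.
  have aux2 : ∀ {c c' : Params}, IsParams m c → IsParams m c' → c.v = c'.v →
      ¬ c.mu < c'.mu := by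
    intro c c' h h' hv hlt
    have e := h.eq_v
    rw [hv, h'.eq_v] at e
    have := h.u_least.2 (show c.z ∈ _ from (gSeq_notMem_setS_iff hm).2
      ⟨c'.mu - c.mu - 1, c'.z, 0, by
        rw [Nat.sub_sub]
        push_cast [Nat.cast_sub (show c.mu + 1 ≤ c'.mu from hlt)]
        linear_combination -e⟩)
    have := h.z_lt
    omega
  have hmu : c.mu = c'.mu :=
    le_antisymm (not_lt.1 (aux2 h' h hv.symm)) (not_lt.1 (aux2 h h' hv))
  have hz : c.z = c'.z := by
    have e := h.eq_v
    rw [hv, h'.eq_v, hmu] at e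
    have e : gSeq m c'.z = gSeq m c.z := by linear_combination e
    rcases lt_trichotomy c.z c'.z with hl | hl | hl
    · exact absurd e (hm.gSeq_lt hl).ne'
    · exact hl
    · exact absurd e (hm.gSeq_lt hl).ne
  have hnu : c.nu = c'.nu := by
    rw [h.nu_eq, h'.nu_eq, hu, hz, hlam, hmu]
  cases c
  cases c'
  simp_all

end Semigroup

section Monomials

variable {p : ℕ} {m : Fin (p + 2) → ℕ}

/-! ### The box `[0, u-1] × [0, υ-1]` and the rectangle `W` -/

/-- For `s < u` no relation `g_s + N m_0 = b m_n` with `1 ≤ b < υ` exists: `N ≥ 0` contradicts the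
minimality of `υ`, and `N < 0` contradicts `g_s ∈ S`. -/
theorem IsParams.gSeq_add_ne (hm : IsAlmostArith m) {c : Params} (hc : IsParams m c)
    {s b : ℕ} (hs : s < c.u) (hb0 : 1 ≤ b) (hb : b < c.v) (N : ℤ) :
    gSeq m s + N * m (ix p 0) ≠ b * m (ix p (p + 1)) := by
  intro h
  rcases le_or_gt 0 N with hN | hN
  · obtain ⟨k, rfl⟩ := Int.eq_ofNat_of_zero_le hN
    have := hc.v_least.2 (show b ∈ _ from
      ⟨hb0, (mem_Gam'_iff hm).2 ⟨k, s, by linear_combination -h⟩⟩)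
    omega
  · obtain ⟨k, hk⟩ := Int.eq_ofNat_of_zero_le (show 0 ≤ -N - 1 by omega)
    have := hc.u_least.2 (show s ∈ _ from (gSeq_notMem_setS_iff hm).2
      ⟨k, 0, b, by
        rw [hm.gSeq_zero, show (k : ℤ) = _ from hk.symm]
        linear_combination h⟩)
    omega

/-- The pairs of the box for which `g_s + b m_n` is a multiple of `m_0` are the origin and pairs
of the upper right corner `W`. -/
theorem IsParams.mem_corner (hm : IsAlmostArith m) {c : Params} (hc : IsParams m c)
    {s b : ℕ} (hs : s < c.u) (hb : b < c.v) {N : ℤ}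
    (h : gSeq m s + b * (m (ix p (p + 1)) : ℤ) = N * m (ix p 0)) :
    (s = 0 ∧ b = 0) ∨ (c.u - c.z ≤ s ∧ c.v - c.w ≤ b) := by
  have hm0 := hm.pos_int 0
  have hmn := hm.pos_int (p + 1)
  have hz := hc.z_lt
  have hw := hc.w_lt
  rcases Nat.eq_zero_or_pos s with rfl | hs0
  · left
    refine ⟨rfl, ?_⟩
    by_contra hb0
    refine hc.gSeq_add_ne hm hs (Nat.pos_of_ne_zero hb0) hb N ?_
    rw [hm.gSeq_zero] at h ⊢
    linear_combination -h
  · right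
    have hgs : 0 < gSeq m s := by
      have := hm.gSeq_lt hs0
      rwa [hm.gSeq_zero] at this
    have hNpos : 0 < N := by
      by_contra hN
      have h1 : 0 ≤ (b : ℤ) * (m (ix p (p + 1)) : ℤ) := by positivity
      nlinarith
    have hb0 : 1 ≤ b := by
      by_contra hb0
      obtain rfl : b = 0 := by omega
      obtain ⟨k, hk⟩ := Int.eq_ofNat_of_zero_le (show 0 ≤ N - 1 by omega)
      have := hc.u_least.2 (show s ∈ _ from (gSeq_notMem_setS_iff hm).2
        ⟨k, 0, 0, by
          rw [hm.gSeq_zero, show (k : ℤ) = _ from hk.symm]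
          push_cast at h ⊢
          linear_combination h⟩)
      omega
    -- Subtracting `h` from the relation for `υ m_n` gives a relation for `(υ - b) m_n`.
    have hsu : c.u ≤ c.z + s := by
      by_contra hlt
      refine hc.gSeq_add_ne hm (s := c.z + s) (b := c.v - b) (by omega) (by omega) (by omega)
        (c.mu - N + defect p c.z s) ?_
      have := hm.gSeq_add c.z s
      push_cast [Nat.cast_sub hb.le]
      linear_combination -this - hc.eq_v + h
    refine ⟨by omega, ?_⟩
    -- Subtracting `h` from the relation for `ν m_0` gives a relation for `(υ - w - b) m_n`.
    by_contra hlt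
    have hle : c.u - c.z ≤ s := by omega
    refine hc.gSeq_add_ne hm (s := s - (c.u - c.z)) (b := c.v - c.w - b) (by omega) (by omega)
      (by omega) (c.nu - N - defect p (c.u - c.z) (s - (c.u - c.z))) ?_
    have := hm.gSeq_add (c.u - c.z) (s - (c.u - c.z))
    rw [Nat.add_sub_cancel' hle] at this
    push_cast [Nat.cast_sub (show b ≤ c.v - c.w by omega), Nat.cast_sub hw.le]
    linear_combination this + h - hc.eq_uz

/-- Outside the corner `W`, the numbers `g_s + b m_n` are pairwise incongruent modulo `m_0`. -/
theorem IsParams.pair_unique (hm : IsAlmostArith m) {c : Params} (hc : IsParams m c)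
    {s b s' b' : ℕ} (hs : s < c.u) (hb : b < c.v) (hW : ¬ (c.u - c.z ≤ s ∧ c.v - c.w ≤ b))
    (hs' : s' < c.u) (hb' : b' < c.v) (hW' : ¬ (c.u - c.z ≤ s' ∧ c.v - c.w ≤ b')) {N : ℤ}
    (h : gSeq m s + b * (m (ix p (p + 1)) : ℤ) =
      N * m (ix p 0) + gSeq m s' + b' * (m (ix p (p + 1)) : ℤ)) :
    s = s' ∧ b = b' := by
  -- The relation is symmetric, so that `s' ≤ s` may be assumed.
  wlog hss : s' ≤ s generalizing s b s' b' N
  · have := this hs' hb' hW' hs hb hW (N := -N) (by linear_combination -h) (by omega)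
    exact ⟨this.1.symm, this.2.symm⟩
  have hadd := hm.gSeq_add s' (s - s')
  rw [Nat.add_sub_cancel' hss] at hadd
  rcases le_or_gt b' b with hbb | hbb
  · have := hc.mem_corner hm (s := s - s') (b := b - b') (by omega) (by omega)
      (N := N + defect p s' (s - s')) (by
        push_cast [Nat.cast_sub hbb]
        linear_combination hadd + h)
    omega
  · exfalso
    refine hc.gSeq_add_ne hm (s := s - s') (b := b' - b) (by omega) (by omega) (by omega)
      (-N - defect p s' (s - s')) ?_
    push_cast [Nat.cast_sub hbb.le]
    linear_combination hadd + h

/-- Since the `m_i` are minimal generators, `g_t = m_t ∈ S` for `1 ≤ t ≤ p`. -/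
theorem IsParams.p_lt_u (hm : IsAlmostArith m) {c : Params} (hc : IsParams m c) : p < c.u := by
  by_contra hle
  have hu0 := least_u_pos hm hc.u_least
  obtain ⟨a, s, b, h⟩ := (gSeq_notMem_setS_iff hm).1 hc.u_least.1
  obtain rfl := eq_zero_of_gSeq_eq hm hc.u_least h
  rw [hm.gSeq_zero, hm.gSeq_of_le hu0 (by omega)] at h
  have h' : m (ix p c.u) = (a + 1) • m (ix p 0) + b • m (ix p (p + 1)) := by
    rw [smul_eq_mul, smul_eq_mul]
    zify
    linear_combination h
  refine hm.minimal (ix p c.u) ?_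
  rw [h']
  have hmem : ∀ i ≤ p + 1, i ≠ c.u →
      m (ix p i) ∈ AddSubmonoid.closure (m '' {ix p c.u}ᶜ) := fun i hi hiu =>
    AddSubmonoid.subset_closure
      ⟨ix p i, fun h => hiu ((ix_inj hi (by omega)).1 h), rfl⟩
  exact add_mem (nsmul_mem (hmem 0 (by omega) (by omega)) _)
    (nsmul_mem (hmem (p + 1) le_rfl (by omega)) _)

/-! ### The exponent vectors of the monomials involved -/

/-- The exponent vector of the variable `x_i`. -/
noncomputable def varExp (p i : ℕ) : Fin (p + 2) →₀ ℕ := Finsupp.single (ix p i) 1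

/-- The exponent vector of `x_{r_t} x_p^{q_t}`, a monomial of weight `g_t`; zero for `t = 0`. -/
noncomputable def gExp (p t : ℕ) : Fin (p + 2) →₀ ℕ :=
  if t = 0 then 0 else varExp p (rt p t) + (qt p t).toNat • varExp p p

theorem varExp_apply {i j : ℕ} (hi : i ≤ p + 1) (hj : j ≤ p + 1) :
    varExp p i (ix p j) = if i = j then 1 else 0 := by
  classical
  rw [varExp, Finsupp.single_apply]
  simp only [ix_inj hi hj]

theorem gExp_zero : gExp p 0 = 0 := if_pos rfl

theorem gExp_mul_add {b i : ℕ} (h1 : 1 ≤ i) (h2 : i ≤ p) :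
    gExp p (b * p + i) = varExp p i + b • varExp p p := by
  obtain ⟨hq, hr⟩ := qt_rt_unique rfl h1 h2 (b := b)
  rw [gExp, if_neg (by omega), hq, hr, Int.toNat_natCast]

theorem exists_eq_mul_add (hp : 1 ≤ p) {t : ℕ} (ht : 1 ≤ t) :
    ∃ b i, t = b * p + i ∧ 1 ≤ i ∧ i ≤ p := by
  obtain ⟨k, hk⟩ := Int.eq_ofNat_of_zero_le (qt_nonneg hp ht)
  obtain ⟨h1, h2, h3⟩ := qt_rt_spec p t hp
  refine ⟨k, rt p t, ?_, h2, h3⟩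
  rw [hk] at h1
  exact_mod_cast h1

theorem wt_nsmul {N : ℕ} (m : Fin N → ℕ) (k : ℕ) (a : Fin N →₀ ℕ) :
    wt m (k • a) = k * wt m a := by
  simp [wt, Finset.mul_sum, mul_assoc]

theorem wt_varExp (i : ℕ) : wt m (varExp p i) = m (ix p i) := by
  classical
  simp [wt, varExp, Finsupp.single_apply]

theorem wt_gExp (hm : IsAlmostArith m) (t : ℕ) : (wt m (gExp p t) : ℤ) = gSeq m t := by
  rcases Nat.eq_zero_or_pos t with rfl | ht
  · rw [gExp_zero, hm.gSeq_zero]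
    simp [wt]
  · rw [gExp, if_neg (by omega), wt_add, wt_nsmul, wt_varExp, wt_varExp, gSeq]
    push_cast
    rw [Int.toNat_of_nonneg (qt_nonneg hm.one_le_p ht)]
    ring

theorem wt_mono {N : ℕ} (m : Fin N → ℕ) {a b : Fin N →₀ ℕ} (h : a ≤ b) : wt m a ≤ wt m b := by
  obtain ⟨c, rfl⟩ := exists_add_of_le h
  rw [wt_add]
  omega

theorem le_of_gExp_le (hm : IsAlmostArith m) {s t : ℕ} (h : gExp p s ≤ gExp p t) : s ≤ t := by
  by_contra hc
  have h1 := hm.gSeq_lt (not_le.1 hc)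
  rw [← wt_gExp hm, ← wt_gExp hm] at h1
  have h2 := wt_mono m h
  omega

/-- The monomial of weight `g_s` is divisible by one of weight `g_{t+j}`, where `t + j ≤ s` and
`j` keeps `t + j` in the block `(q_t p, (q_t + 1) p]` of `t`. -/
theorem exists_gExp_le (hp : 1 ≤ p) {s t : ℕ} (ht : 1 ≤ t) (hts : t ≤ s) :
    ∃ j, j ≤ p - rt p t ∧ j ≤ s - t ∧ gExp p (t + j) ≤ gExp p s := by
  obtain ⟨b, i, rfl, hi1, hi2⟩ := exists_eq_mul_add hp ht
  obtain ⟨b', i', rfl, hi1', hi2'⟩ := exists_eq_mul_add hp (ht.trans hts)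
  rw [(qt_rt_unique rfl hi1 hi2).2]
  have hbb : b ≤ b' := by
    by_contra hc
    obtain ⟨k, rfl⟩ := Nat.exists_eq_add_of_lt (not_le.1 hc)
    nlinarith [Nat.zero_le (k * p)]
  rcases hbb.eq_or_lt with rfl | hlt
  · exact ⟨i' - i, by omega, by omega, le_of_eq (by congr 1; omega)⟩
  · obtain ⟨k, rfl⟩ := Nat.exists_eq_add_of_lt hlt
    refine ⟨p - i, le_rfl, ?_, ?_⟩
    · have : (b + k + 1) * p = b * p + k * p + p := by ring
      omega
    · rw [show b * p + i + (p - i) = b * p + p by omega, gExp_mul_add hp le_rfl,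
        gExp_mul_add hi1' hi2']
      intro l
      simp only [Finsupp.add_apply, Finsupp.smul_apply, smul_eq_mul]
      nlinarith [Nat.zero_le (k * varExp p p l), Nat.zero_le (varExp p i' l)]

theorem gExp_apply_rt_pos (hp : 1 ≤ p) {t : ℕ} (ht : 1 ≤ t) : 1 ≤ gExp p t (ix p (rt p t)) := by
  have h := (qt_rt_spec p t hp).2.2
  rw [gExp, if_neg (by omega), Finsupp.add_apply, varExp_apply (by omega) (by omega), if_pos rfl]
  omega

theorem gExp_apply_p_pos (hp : 1 ≤ p) {t : ℕ} (ht : p < t) : 1 ≤ gExp p t (ix p p) := by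
  obtain ⟨b, i, rfl, hi1, hi2⟩ := exists_eq_mul_add hp (hp.trans ht.le)
  have hb : 1 ≤ b := by
    by_contra hb
    obtain rfl : b = 0 := by omega
    omega
  rw [gExp_mul_add hi1 hi2, Finsupp.add_apply, Finsupp.smul_apply,
    varExp_apply (by omega) (by omega), varExp_apply (by omega) (by omega), if_pos rfl]
  simp only [smul_eq_mul]
  omega

theorem gExp_apply_of_lt (hp : 1 ≤ p) {t j : ℕ} (hj : j < p) :
    gExp p t (ix p j) = if t ≠ 0 ∧ rt p t = j then 1 else 0 := by
  have h := (qt_rt_spec p t hp).2.2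
  by_cases ht : t = 0
  · simp [ht, gExp_zero]
  · rw [gExp, if_neg ht, Finsupp.add_apply, Finsupp.smul_apply,
      varExp_apply (by omega) (by omega), varExp_apply (by omega) (by omega)]
    simp [ht, hj.ne']

theorem gExp_apply_last (hp : 1 ≤ p) (t : ℕ) : gExp p t (ix p (p + 1)) = 0 := by
  have h := (qt_rt_spec p t hp).2.2
  by_cases ht : t = 0
  · simp [ht, gExp_zero]
  · rw [gExp, if_neg ht, Finsupp.add_apply, Finsupp.smul_apply,
      varExp_apply (by omega) (by omega), varExp_apply (by omega) (by omega)]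
    simp
    omega

theorem gExp_apply_zero (hp : 1 ≤ p) (t : ℕ) : gExp p t (ix p 0) = 0 := by
  have h := (qt_rt_spec p t hp).2.1
  rw [gExp_apply_of_lt hp (by omega), if_neg (by omega)]

/-- Divisibility between `g`-monomials is not affected by powers of `x_n`. -/
theorem gExp_le_of_le_add (hp : 1 ≤ p) {s t b : ℕ} {a : Fin (p + 2) →₀ ℕ}
    (h : gExp p s + a ≤ gExp p t + b • varExp p (p + 1)) : gExp p s ≤ gExp p t := by
  intro k
  obtain ⟨i, hi, rfl⟩ := exists_ix k
  by_cases hip : i = p + 1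
  · rw [hip, gExp_apply_last hp]
    omega
  · have := h (ix p i)
    rw [Finsupp.add_apply, Finsupp.add_apply, Finsupp.smul_apply,
      varExp_apply le_rfl hi, if_neg (Ne.symm hip)] at this
    simp only [smul_eq_mul] at this
    omega

theorem varExp_le_varExp {i j : ℕ} (hi : i ≤ p + 1) (hj : j ≤ p + 1)
    (h : varExp p i ≤ varExp p j) : i = j := by
  have := h (ix p i)
  rw [varExp_apply hi hi, varExp_apply hj hi, if_pos rfl] at this
  by_contra hc
  rw [if_neg (Ne.symm hc)] at this
  omega

/-- Two `g`-monomials in the same block do not divide each other. -/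
theorem eq_of_gExp_add_le (hp : 1 ≤ p) {t i j : ℕ} (ht : 1 ≤ t) (hi : i ≤ p - rt p t)
    (hj : j ≤ p - rt p t) (h : gExp p (t + i) ≤ gExp p (t + j)) : i = j := by
  obtain ⟨b, k, rfl, hk1, hk2⟩ := exists_eq_mul_add hp ht
  rw [(qt_rt_unique rfl hk1 hk2).2] at hi hj
  rw [add_assoc, add_assoc, gExp_mul_add (by omega) (by omega),
    gExp_mul_add (by omega) (by omega)] at h
  have := varExp_le_varExp (by omega) (by omega) (le_of_add_le_add_right h)
  omega

/-- No product `x_i x_j` with `i ≤ j ≤ p - 1` divides a `g`-monomial times a power of `x_n`. -/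
theorem not_varExp_add_le (hp : 1 ≤ p) {i j t b : ℕ} (hij : i ≤ j)
    (hj : j ≤ p - 1) : ¬ varExp p i + varExp p j ≤ gExp p t + b • varExp p (p + 1) := by
  intro h
  have h1 := h (ix p i)
  have h2 := h (ix p j)
  simp only [Finsupp.add_apply, Finsupp.smul_apply] at h1 h2
  rw [varExp_apply (by omega) (by omega), varExp_apply (by omega) (by omega),
    varExp_apply (by omega) (by omega), gExp_apply_of_lt hp (by omega)] at h1 h2
  simp only [smul_eq_mul] at h1 h2
  split_ifs at h1 h2 <;> omega

theorem varExp_add_le_inj {i j i' j' : ℕ} (hij : i ≤ j) (hj : j ≤ p - 1)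
    (hij' : i' ≤ j') (hj' : j' ≤ p - 1)
    (h : varExp p i + varExp p j ≤ varExp p i' + varExp p j') : i = i' ∧ j = j' := by
  have h1 := h (ix p i)
  have h2 := h (ix p j)
  simp only [Finsupp.add_apply] at h1 h2
  rw [varExp_apply (by omega) (by omega), varExp_apply (by omega) (by omega),
    varExp_apply (by omega) (by omega), varExp_apply (by omega) (by omega)] at h1 h2
  split_ifs at h1 h2 <;> omega

/-- A monomial not divisible by any `x_i x_j` with `1 ≤ i ≤ j ≤ p - 1` is a power of `x_0` times a
`g`-monomial times a power of `x_n`. -/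
theorem exists_normal_form (hp : 1 ≤ p) (f : Fin (p + 2) →₀ ℕ)
    (hf : ∀ i j, 1 ≤ i → i ≤ j → j ≤ p - 1 → ¬ varExp p i + varExp p j ≤ f) :
    ∃ a s b : ℕ, f = a • varExp p 0 + gExp p s + b • varExp p (p + 1) := by
  by_cases hex : ∃ i, 1 ≤ i ∧ i ≤ p - 1 ∧ f (ix p i) ≠ 0
  · obtain ⟨i, hi1, hi2, hfi⟩ := hex
    have hone : f (ix p i) = 1 := by
      by_contra hc
      refine hf i i hi1 le_rfl hi2 fun k => ?_
      obtain ⟨l, hl, rfl⟩ := exists_ix k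
      rw [Finsupp.add_apply, varExp_apply (by omega) hl]
      split_ifs with h
      · subst h
        omega
      · omega
    have hother : ∀ j, 1 ≤ j → j ≤ p - 1 → j ≠ i → f (ix p j) = 0 := by
      intro j hj1 hj2 hji
      by_contra hc
      have hle : varExp p i + varExp p j ≤ f := by
        intro k
        obtain ⟨l, hl, rfl⟩ := exists_ix k
        rw [Finsupp.add_apply, varExp_apply (by omega) hl, varExp_apply (by omega) hl]
        split_ifs with h h' h'
        · omega
        · subst h
          omega
        · subst h'
          omega
        · omega
      rcases le_total i j with h | h
      · exact hf i j hi1 h hj2 hle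
      · exact hf j i hj1 h hi2 ((add_comm _ _).trans_le hle)
    refine ⟨f (ix p 0), f (ix p p) * p + i, f (ix p (p + 1)), ?_⟩
    rw [gExp_mul_add hi1 (by omega)]
    ext k
    obtain ⟨l, hl, rfl⟩ := exists_ix k
    simp only [Finsupp.add_apply, Finsupp.smul_apply, smul_eq_mul]
    rw [varExp_apply (by omega) hl, varExp_apply (by omega) hl, varExp_apply (by omega) hl,
      varExp_apply (by omega) hl]
    rcases (show l = 0 ∨ l = i ∨ l = p ∨ l = p + 1 ∨ (1 ≤ l ∧ l ≤ p - 1 ∧ l ≠ i) by omega) with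
      rfl | rfl | rfl | rfl | ⟨h1, h2, h3⟩
    · rw [if_pos rfl, if_neg (by omega), if_neg (by omega), if_neg (by omega)]
      omega
    on_goal 3 =>
      rw [if_neg (by omega), if_neg (by omega),
        if_neg (by omega), if_pos rfl]
    on_goal 4 => have := hother l h1 h2 h3
    all_goals try split_ifs
    all_goals omega
  · push Not at hex
    have hg : gExp p (f (ix p p) * p) = f (ix p p) • varExp p p := by
      rcases Nat.eq_zero_or_pos (f (ix p p)) with h | h
      · rw [h, Nat.zero_mul, gExp_zero, zero_smul]
      · obtain ⟨k, hk⟩ : ∃ k, f (ix p p) = k + 1 := Nat.exists_eq_add_of_le' h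
        rw [hk, add_mul, one_mul, gExp_mul_add hp le_rfl, add_smul, one_smul]
        exact add_comm _ _
    refine ⟨f (ix p 0), f (ix p p) * p, f (ix p (p + 1)), ?_⟩
    rw [hg]
    ext k
    obtain ⟨l, hl, rfl⟩ := exists_ix k
    simp only [Finsupp.add_apply, Finsupp.smul_apply, smul_eq_mul]
    rw [varExp_apply (by omega) hl, varExp_apply (by omega) hl, varExp_apply (by omega) hl]
    rcases (show l = 0 ∨ l = p ∨ l = p + 1 ∨ (1 ≤ l ∧ l ≤ p - 1) by omega) with
      rfl | rfl | rfl | ⟨h1, h2⟩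
    · rw [if_pos rfl, if_neg (by omega), if_neg (by omega)]
      omega
    on_goal 2 =>
      rw [if_neg (by omega), if_neg (by omega), if_pos rfl]
    on_goal 3 => have := hex l h1 h2
    all_goals try split_ifs
    all_goals omega

end Monomials

section Basis

variable {p : ℕ} {m : Fin (p + 2) → ℕ}

/-! ### The exponent pairs of the binomials in `Φ` -/

/-- The exponents of `φ_i`; its leading monomial is the `g`-monomial of index `u + i`. -/
noncomputable def phiPair (p : ℕ) (c : Params) (i : ℕ) :
    (Fin (p + 2) →₀ ℕ) × (Fin (p + 2) →₀ ℕ) :=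
  (gExp p (c.u + i),
    (c.lam - 1) • varExp p 0 + varExp p i + c.w • varExp p (p + 1))

/-- The exponents of `ψ_j`; its leading monomial is the `g`-monomial of index `u - z + j` times
`x_n^(υ-w)`. -/
noncomputable def psiPair (p : ℕ) (c : Params) (j : ℕ) :
    (Fin (p + 2) →₀ ℕ) × (Fin (p + 2) →₀ ℕ) :=
  (gExp p (c.u - c.z + j) + (c.v - c.w) • varExp p (p + 1),
    (c.nu - 1) • varExp p 0 + varExp p j)

/-- The exponents of `θ`. -/
noncomputable def thetaPair (p : ℕ) (c : Params) :
    (Fin (p + 2) →₀ ℕ) × (Fin (p + 2) →₀ ℕ) :=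
  (c.v • varExp p (p + 1), c.mu • varExp p 0 + gExp p c.z)

/-- The exponents of `ξ_{i,j}`. -/
noncomputable def xiPair (p : ℕ) (k : ℕ × ℕ) : (Fin (p + 2) →₀ ℕ) × (Fin (p + 2) →₀ ℕ) :=
  (varExp p k.1 + varExp p k.2,
    if k.1 + k.2 ≤ p then varExp p 0 + varExp p (k.1 + k.2)
    else varExp p (k.1 + k.2 - p) + varExp p p)

/-- The index set of the binomials `ξ_{i,j}`. -/
def xiIndex (p : ℕ) : Set (ℕ × ℕ) := {k | 1 ≤ k.1 ∧ k.1 ≤ k.2 ∧ k.2 ≤ p - 1}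

/-- The exponent pairs of all elements of `Φ`. -/
noncomputable def PhiPairs (p : ℕ) (c : Params) : Set ((Fin (p + 2) →₀ ℕ) × (Fin (p + 2) →₀ ℕ)) :=
  phiPair p c '' {i | i ≤ p - r p c} ∪ psiPair p c '' J p c ∪ {thetaPair p c} ∪
    xiPair p '' xiIndex p

theorem PhiPairs_finite (c : Params) : (PhiPairs p c).Finite := by
  refine Set.Finite.union (Set.Finite.union (Set.Finite.union ?_ ?_) (Set.finite_singleton _)) ?_
  · exact (Set.finite_Iic _).image _
  · exact (Finset.finite_toSet _).image _
  · refine Set.Finite.image _ (((Set.finite_Iic (p - 1)).prod (Set.finite_Iic (p - 1))).subset ?_)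
    rintro ⟨i, j⟩ ⟨-, h2, h3⟩
    exact ⟨h2.trans h3, h3⟩

theorem monomial_varExp (K : Type*) [Field K] (i : ℕ) :
    MvPolynomial.monomial (varExp p i) (1 : K) = x K p i := rfl

theorem monomial_add_one {σ : Type*} (K : Type*) [Field K] (a b : σ →₀ ℕ) :
    MvPolynomial.monomial (a + b) (1 : K) =
      MvPolynomial.monomial a 1 * MvPolynomial.monomial b 1 := by
  rw [MvPolynomial.monomial_mul, one_mul]

theorem monomial_nsmul_varExp (K : Type*) [Field K] (k i : ℕ) :
    MvPolynomial.monomial (k • varExp p i) (1 : K) = x K p i ^ k := by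
  rw [← monomial_varExp, MvPolynomial.monomial_pow, one_pow]

theorem monomial_gExp (K : Type*) [Field K] (t : ℕ) :
    MvPolynomial.monomial (gExp p t) (1 : K) = gMon K p t := by
  unfold gExp gMon
  split_ifs
  · rfl
  · rw [monomial_add_one, monomial_nsmul_varExp, monomial_varExp]

/-- Within the block of `t`, the index `r_t` moves and `q_t` stays. -/
theorem gExp_add (hp : 1 ≤ p) {t i : ℕ} (ht : 1 ≤ t) (hi : i ≤ p - rt p t) :
    gExp p (t + i) = varExp p (rt p t + i) + (qt p t).toNat • varExp p p := by
  obtain ⟨b, k, rfl, hk1, hk2⟩ := exists_eq_mul_add hp ht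
  obtain ⟨hq, hr⟩ := qt_rt_unique rfl hk1 hk2 (b := b)
  rw [hr] at hi
  rw [hq, hr, Int.toNat_natCast, add_assoc, gExp_mul_add (by omega) (by omega)]

theorem qt_add (hp : 1 ≤ p) {t i : ℕ} (ht : 1 ≤ t) (hi : i ≤ p - rt p t) :
    qt p (t + i) = qt p t := by
  obtain ⟨b, k, rfl, hk1, hk2⟩ := exists_eq_mul_add hp ht
  obtain ⟨hq, hr⟩ := qt_rt_unique rfl hk1 hk2 (b := b)
  rw [hr] at hi
  rw [hq]
  exact (qt_rt_unique (add_assoc _ _ _) (by omega) (by omega)).1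

theorem mem_J_iff {c : Params} (hz : c.z < c.u) (hw : c.w < c.v) {j : ℕ} :
    j ∈ J p c ↔ 1 ≤ c.z ∧ 1 ≤ c.w ∧ j ≤ c.z - 1 ∧ j ≤ p - r' p c := by
  have hW : W c = ∅ ↔ c.z = 0 ∨ c.w = 0 := by
    rw [W, Finset.product_eq_empty, Finset.Icc_eq_empty_iff, Finset.Icc_eq_empty_iff]
    omega
  unfold J
  split_ifs with h
  · rw [hW] at h
    simp only [Finset.notMem_empty, false_iff]
    omega
  · rw [hW] at h
    rw [Finset.mem_Icc, le_min_iff]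
    omega

theorem binomial_PhiPairs (K : Type*) [Field K] (hp : 1 ≤ p) {c : Params} (hz : c.z < c.u)
    (hw : c.w < c.v) : binomial K '' PhiPairs p c = Phi K p c := by
  have hphi : ∀ i ≤ p - r p c, binomial K (phiPair p c i) = phi K p c i := by
    intro i hi
    simp only [binomial, phiPair, phi]
    rw [gExp_add hp (by omega) hi]
    simp only [monomial_add_one, monomial_nsmul_varExp, monomial_varExp]
    rfl
  have hpsi : ∀ j ∈ J p c, binomial K (psiPair p c j) = psi K p c j := by
    intro j hj
    simp only [binomial, psiPair, psi]
    rw [gExp_add hp (by omega) ((mem_J_iff hz hw).1 hj).2.2.2]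
    simp only [monomial_add_one, monomial_nsmul_varExp, monomial_varExp]
    rfl
  have htheta : binomial K (thetaPair p c) = theta K p c := by
    simp only [binomial, thetaPair, theta, monomial_add_one, monomial_nsmul_varExp, monomial_gExp]
  have hxi : ∀ i j, binomial K (xiPair p (i, j)) = xi K p i j := by
    intro i j
    simp only [binomial, xiPair, xi]
    split_ifs <;> simp only [monomial_add_one, monomial_varExp]
  rw [PhiPairs, Phi, Set.image_union, Set.image_union, Set.image_union, Set.image_singleton, htheta]
  congr 1
  · congr 1
    congr 1
    · ext f
      constructor
      · rintro ⟨_, ⟨i, hi, rfl⟩, rfl⟩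
        exact ⟨i, hi, hphi i hi⟩
      · rintro ⟨i, hi, rfl⟩
        exact ⟨_, ⟨i, hi, rfl⟩, hphi i hi⟩
    · ext f
      constructor
      · rintro ⟨_, ⟨i, hi, rfl⟩, rfl⟩
        exact ⟨i, hi, hpsi i hi⟩
      · rintro ⟨i, hi, rfl⟩
        exact ⟨_, ⟨i, hi, rfl⟩, hpsi i hi⟩
  · ext f
    constructor
    · rintro ⟨_, ⟨⟨i, j⟩, ⟨h1, h2, h3⟩, rfl⟩, rfl⟩
      exact ⟨i, j, h1, h2, h3, hxi i j⟩
    · rintro ⟨i, j, h1, h2, h3, rfl⟩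
      exact ⟨_, ⟨(i, j), ⟨h1, h2, h3⟩, rfl⟩, hxi i j⟩

/-! ### Weights and leading monomials -/

theorem PhiPairs_wt (hm : IsAlmostArith m) {c : Params} (hc : IsParams m c)
    {d : (Fin (p + 2) →₀ ℕ) × (Fin (p + 2) →₀ ℕ)} (hd : d ∈ PhiPairs p c) :
    wt m d.1 = wt m d.2 := by
  have hp := hm.one_le_p
  have hz := hc.z_lt
  have hw := hc.w_lt
  have hlam := hc.one_le_lam
  have hnu := hc.two_le_nu
  obtain ⟨e, -, harith, hg⟩ := hm.gSeq_eq
  have hgu := hc.eq_u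
  have hguz := hc.eq_uz
  zify
  rcases hd with ((⟨i, hi, rfl⟩ | ⟨j, hj, rfl⟩) | rfl) | ⟨⟨i, j⟩, ⟨h1, h2, h3⟩, rfl⟩
  · have hir : i ≤ p - rt p c.u := hi
    simp only [phiPair]
    rw [wt_gExp hm]
    simp only [wt_add, wt_nsmul, wt_varExp]
    rw [harith i (by omega), hg, qt_add hp (by omega) hir]
    rw [hg] at hgu
    push_cast [Nat.cast_sub hlam]
    linear_combination hgu
  · obtain ⟨hz1, hw1, hj1, hj2⟩ := (mem_J_iff hz hw).1 hj
    have hjr : j ≤ p - rt p (c.u - c.z) := hj2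
    simp only [psiPair]
    rw [wt_add, Nat.cast_add, wt_gExp hm]
    simp only [wt_add, wt_nsmul, wt_varExp]
    rw [harith j (by omega), hg, qt_add hp (by omega) hjr]
    rw [hg] at hguz
    push_cast [Nat.cast_sub hw.le, Nat.cast_sub (show 1 ≤ c.nu by omega)] at hguz ⊢
    linear_combination hguz
  · have := hc.eq_v
    simp only [thetaPair]
    rw [wt_add, Nat.cast_add, wt_gExp hm]
    simp only [wt_nsmul, wt_varExp]
    push_cast
    linear_combination this
  · simp only at h1 h2 h3
    simp only [xiPair]
    split_ifs with h
    · simp only [wt_add, wt_varExp]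
      rw [harith i (by omega), harith j (by omega), harith (i + j) h]
      push_cast
      ring
    · simp only [wt_add, wt_varExp]
      rw [harith i (by omega), harith j (by omega), harith (i + j - p) (by omega),
        harith p le_rfl]
      push_cast [Nat.cast_sub (show p ≤ i + j by omega)]
      ring

/-- Among monomials of equal weight, a larger exponent at the first difference is smaller. -/
theorem toSyn_lt_of_first_diff (hpos : ∀ i, 0 < m i) {a b : Fin (p + 2) →₀ ℕ}
    (h : wt m a = wt m b) (k : ℕ) (hk : k ≤ p + 1) (h1 : ∀ j < k, b (ix p j) = a (ix p j))
    (h2 : a (ix p k) < b (ix p k)) :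
    (wGrevlex m hpos).toSyn b < (wGrevlex m hpos).toSyn a := by
  rw [wGrevlex_lt_iff]
  refine Or.inr ⟨h.symm, ix p k, fun l hl => ?_, h2⟩
  obtain ⟨j, hj, rfl⟩ := exists_ix l
  rw [Fin.lt_def, ix_val hj, ix_val hk] at hl
  exact h1 j hl

theorem PhiPairs_lt (hm : IsAlmostArith m) {c : Params} (hc : IsParams m c)
    {d : (Fin (p + 2) →₀ ℕ) × (Fin (p + 2) →₀ ℕ)} (hd : d ∈ PhiPairs p c) :
    (wGrevlex m hm.pos).toSyn d.2 < (wGrevlex m hm.pos).toSyn d.1 := by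
  have hp := hm.one_le_p
  have hz := hc.z_lt
  have hw := hc.w_lt
  have hwt := PhiPairs_wt hm hc hd
  rcases hd with ((⟨i, hi, rfl⟩ | ⟨j, hj, rfl⟩) | rfl) | ⟨⟨i, j⟩, ⟨h1, h2, h3⟩, rfl⟩
  · have hir : i ≤ p - rt p c.u := hi
    obtain ⟨-, hr1, hr2⟩ := qt_rt_spec p c.u hp
    by_cases hcase : c.lam - 1 ≠ 0 ∨ i = 0
    · refine toSyn_lt_of_first_diff hm.pos hwt 0 (by omega) (by omega) ?_
      simp only [phiPair, Finsupp.add_apply, Finsupp.smul_apply, smul_eq_mul]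
      rw [gExp_apply_zero hp, varExp_apply (by omega) (by omega),
        varExp_apply (by omega) (by omega), if_pos rfl]
      split_ifs <;> omega
    -- If `λ = 1` and `i ≥ 1`, the first difference is at `x_i`, as `i < r + i`.
    · refine toSyn_lt_of_first_diff hm.pos hwt i (by omega) (fun k hk => ?_) ?_ <;>
        simp only [phiPair, Finsupp.add_apply, Finsupp.smul_apply, smul_eq_mul] <;>
        rw [gExp_add hp (by omega) hir] <;>
        simp only [Finsupp.add_apply, Finsupp.smul_apply, smul_eq_mul] <;>
        rw [varExp_apply (by omega) (by omega), varExp_apply (by omega) (by omega),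
          varExp_apply (by omega) (by omega), varExp_apply (by omega) (by omega),
          varExp_apply (by omega) (by omega)]
      · rw [if_neg (show ¬ i = k by omega), if_neg (show ¬ p + 1 = k by omega),
          if_neg (show ¬ rt p c.u + i = k by omega), if_neg (show ¬ p = k by omega)]
        have : c.lam - 1 = 0 := by omega
        rw [this]
        omega
      · rw [if_pos rfl, if_neg (show ¬ rt p c.u + i = i by omega),
          if_neg (show ¬ p = i by omega)]
        omega
  · have hnu := hc.two_le_nu
    obtain ⟨-, -, -, hj2⟩ := (mem_J_iff hz hw).1 hj
    refine toSyn_lt_of_first_diff hm.pos hwt 0 (by omega) (by omega) ?_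
    simp only [psiPair, Finsupp.add_apply, Finsupp.smul_apply, smul_eq_mul]
    rw [gExp_apply_zero hp, varExp_apply (by omega) (by omega),
      varExp_apply (by omega) (by omega), if_pos rfl, if_neg (by omega)]
    omega
  · by_cases hmu : c.mu = 0
    -- If `μ = 0`, then `z ≥ 1`, and the first difference is at `x_{r_z}`.
    · have hz0 : 1 ≤ c.z := by
        by_contra hz0
        have h0 : c.z = 0 := by omega
        have h := hc.eq_v
        rw [hmu, h0, hm.gSeq_zero] at h
        have h1 := hm.pos_int (p + 1)
        have h2 : (0 : ℤ) < c.v := by omega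
        have := mul_pos h2 h1
        push_cast at h
        omega
      obtain ⟨-, hr1, hr2⟩ := qt_rt_spec p c.z hp
      refine toSyn_lt_of_first_diff hm.pos hwt (rt p c.z) (by omega) (fun k hk => ?_) ?_
      · simp only [thetaPair, Finsupp.add_apply, Finsupp.smul_apply, smul_eq_mul]
        rw [hmu, gExp_apply_of_lt hp (by omega), if_neg (by omega),
          varExp_apply (by omega) (by omega), varExp_apply (by omega) (by omega),
          if_neg (show ¬ p + 1 = k by omega)]
        omega
      · have := gExp_apply_rt_pos hp hz0
        simp only [thetaPair, Finsupp.add_apply, Finsupp.smul_apply, smul_eq_mul]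
        rw [varExp_apply (by omega) (by omega), if_neg (show ¬ p + 1 = rt p c.z by omega)]
        omega
    · refine toSyn_lt_of_first_diff hm.pos hwt 0 (by omega) (by omega) ?_
      simp only [thetaPair, Finsupp.add_apply, Finsupp.smul_apply, smul_eq_mul]
      rw [gExp_apply_zero hp, varExp_apply (by omega) (by omega),
        varExp_apply (by omega) (by omega), if_pos rfl, if_neg (by omega)]
      omega
  · simp only at h1 h2 h3
    -- The first difference is at `x_0` if `i + j ≤ p`, and at `x_{i+j-p}` otherwise.
    by_cases h : i + j ≤ p
    · refine toSyn_lt_of_first_diff hm.pos hwt 0 (by omega) (by omega) ?_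
      simp only [xiPair, if_pos h, Finsupp.add_apply]
      rw [varExp_apply (by omega) (by omega), varExp_apply (by omega) (by omega),
        varExp_apply (by omega) (by omega), varExp_apply (by omega) (by omega)]
      split_ifs <;> omega
    · refine toSyn_lt_of_first_diff hm.pos hwt (i + j - p) (by omega) (fun k hk => ?_) ?_ <;>
        simp only [xiPair, if_neg h, Finsupp.add_apply] <;>
        rw [varExp_apply (by omega) (by omega), varExp_apply (by omega) (by omega),
          varExp_apply (by omega) (by omega), varExp_apply (by omega) (by omega)] <;>
        split_ifs <;> omega

/-! ### Normal monomials and the antichain of leading monomials -/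

/-- The monomials outside the initial ideal are those `x_0^a x_{r_s} x_p^{q_s} x_n^b` with `(s, b)`
in the box and outside `W`. -/
theorem exists_normal_form_box (hm : IsAlmostArith m) {c : Params} (hc : IsParams m c)
    {f : Fin (p + 2) →₀ ℕ} (hf : ∀ d ∈ PhiPairs p c, ¬ d.1 ≤ f) :
    ∃ a s b : ℕ, f = a • varExp p 0 + gExp p s + b • varExp p (p + 1) ∧ s < c.u ∧ b < c.v ∧
      ¬ (c.u - c.z ≤ s ∧ c.v - c.w ≤ b) := by
  have hp := hm.one_le_p
  have hz := hc.z_lt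
  have hw := hc.w_lt
  obtain ⟨a, s, b, rfl⟩ := exists_normal_form hp f fun i j h1 h2 h3 =>
    hf _ (Or.inr ⟨(i, j), ⟨h1, h2, h3⟩, rfl⟩)
  have hsu : s < c.u := by
    by_contra hcon
    obtain ⟨j, hj1, -, hj3⟩ := exists_gExp_le hp (show 1 ≤ c.u by omega) (not_lt.1 hcon)
    refine hf _ (Or.inl (Or.inl (Or.inl ⟨j, hj1, rfl⟩))) ?_
    exact hj3.trans ((le_add_of_nonneg_left zero_le).trans
      (le_add_of_nonneg_right zero_le))
  have hbv : b < c.v := by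
    by_contra hcon
    refine hf _ (Or.inl (Or.inr rfl)) ?_
    exact (nsmul_le_nsmul_left zero_le (not_lt.1 hcon)).trans
      (le_add_of_nonneg_left zero_le)
  refine ⟨a, s, b, rfl, hsu, hbv, fun ⟨h1, h2⟩ => ?_⟩
  obtain ⟨j, hj1, hj2, hj3⟩ := exists_gExp_le hp (show 1 ≤ c.u - c.z by omega) h1
  refine hf _ (Or.inl (Or.inl (Or.inr ⟨j, ?_, rfl⟩))) ?_
  · exact (mem_J_iff hz hw).2 ⟨by omega, by omega, by omega, hj1⟩
  · exact add_le_add (hj3.trans (le_add_of_nonneg_left zero_le))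
      (nsmul_le_nsmul_left zero_le h2)

theorem normal_form_unique (hm : IsAlmostArith m) {c : Params} (hc : IsParams m c)
    {f f' : Fin (p + 2) →₀ ℕ} (hf : ∀ d ∈ PhiPairs p c, ¬ d.1 ≤ f)
    (hf' : ∀ d ∈ PhiPairs p c, ¬ d.1 ≤ f') (h : wt m f = wt m f') : f = f' := by
  obtain ⟨a, s, b, rfl, hs, hb, hW⟩ := exists_normal_form_box hm hc hf
  obtain ⟨a', s', b', rfl, hs', hb', hW'⟩ := exists_normal_form_box hm hc hf'
  zify at h
  simp only [wt_add, Nat.cast_add, wt_gExp hm, wt_nsmul, wt_varExp, Nat.cast_mul] at h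
  obtain ⟨rfl, rfl⟩ := hc.pair_unique hm hs hb hW hs' hb' hW' (N := (a' : ℤ) - a)
    (by linear_combination h)
  have h0 : (a : ℤ) * (m (ix p 0) : ℤ) = a' * (m (ix p 0) : ℤ) := by linear_combination h
  have := mul_right_cancel₀ (hm.pos_int 0).ne' h0
  obtain rfl : a = a' := by exact_mod_cast this
  rfl

theorem PhiPairs_antichain (hm : IsAlmostArith m) {c : Params} (hc : IsParams m c)
    {d d' : (Fin (p + 2) →₀ ℕ) × (Fin (p + 2) →₀ ℕ)} (hd : d ∈ PhiPairs p c)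
    (hd' : d' ∈ PhiPairs p c) (h : d.1 ≤ d'.1) : d = d' := by
  have hp := hm.one_le_p
  have hz := hc.z_lt
  have hw := hc.w_lt
  have hpu := hc.p_lt_u hm
  -- Exponents of `x_n` and of `x_p`, and of `x_{r_t}` for `t = u - z + j`, rule out most cases.
  have hlast := h (ix p (p + 1))
  have hpp := h (ix p p)
  rcases hd with ((⟨i, hi, rfl⟩ | ⟨j, hj, rfl⟩) | rfl) | ⟨⟨i, j⟩, ⟨h1, h2, h3⟩, rfl⟩ <;>
    rcases hd' with ((⟨i', hi', rfl⟩ | ⟨j', hj', rfl⟩) | rfl) | ⟨⟨i', j'⟩, ⟨h1', h2', h3'⟩, rfl⟩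
  · obtain rfl := eq_of_gExp_add_le hp (by omega) hi hi' h
    rfl
  · obtain ⟨hz1, -, hj1', -⟩ := (mem_J_iff hz hw).1 hj'
    have := le_of_gExp_le hm (gExp_le_of_le_add hp (a := 0) ((add_zero _).trans_le h))
    omega
  · exfalso
    have := gExp_apply_p_pos hp (t := c.u + i) (by omega)
    simp only [phiPair, thetaPair, Finsupp.smul_apply, smul_eq_mul] at hpp
    rw [varExp_apply (by omega) (by omega), if_neg (by omega)] at hpp
    omega
  · exfalso
    simp only at h1' h2' h3'
    have := gExp_apply_p_pos hp (t := c.u + i) (by omega)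
    simp only [phiPair, xiPair, Finsupp.add_apply] at hpp
    rw [varExp_apply (by omega) (by omega), varExp_apply (by omega) (by omega),
      if_neg (by omega), if_neg (by omega)] at hpp
    omega
  · exfalso
    simp only [phiPair, psiPair, Finsupp.add_apply, Finsupp.smul_apply, smul_eq_mul] at hlast
    rw [gExp_apply_last hp, gExp_apply_last hp, varExp_apply le_rfl le_rfl, if_pos rfl] at hlast
    omega
  · obtain ⟨-, -, -, hj2⟩ := (mem_J_iff hz hw).1 hj
    obtain ⟨-, -, -, hj2'⟩ := (mem_J_iff hz hw).1 hj'
    obtain rfl := eq_of_gExp_add_le hp (by omega) hj2 hj2' (le_of_add_le_add_right h)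
    rfl
  · exfalso
    have h0 := gExp_apply_rt_pos hp (t := c.u - c.z + j) (by omega)
    have h1 := h (ix p (rt p (c.u - c.z + j)))
    obtain ⟨-, -, hr⟩ := qt_rt_spec p (c.u - c.z + j) hp
    simp only [psiPair, thetaPair, Finsupp.add_apply, Finsupp.smul_apply, smul_eq_mul] at h1
    rw [varExp_apply (by omega) (by omega), if_neg (by omega)] at h1
    omega
  · exfalso
    simp only at h1' h2' h3'
    simp only [psiPair, xiPair, Finsupp.add_apply, Finsupp.smul_apply, smul_eq_mul] at hlast
    rw [varExp_apply (by omega) (by omega), varExp_apply (by omega) (by omega),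
      varExp_apply (by omega) (by omega), if_pos rfl, if_neg (by omega),
      if_neg (by omega)] at hlast
    omega
  · exfalso
    simp only [phiPair, thetaPair, Finsupp.smul_apply, smul_eq_mul] at hlast
    rw [gExp_apply_last hp, varExp_apply le_rfl le_rfl, if_pos rfl] at hlast
    omega
  · exfalso
    obtain ⟨-, hw1, -, -⟩ := (mem_J_iff hz hw).1 hj'
    simp only [psiPair, thetaPair, Finsupp.add_apply, Finsupp.smul_apply, smul_eq_mul] at hlast
    rw [gExp_apply_last hp, varExp_apply le_rfl le_rfl, if_pos rfl] at hlast
    omega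
  · rfl
  · exfalso
    simp only at h1' h2' h3'
    simp only [thetaPair, xiPair, Finsupp.add_apply, Finsupp.smul_apply, smul_eq_mul] at hlast
    rw [varExp_apply (by omega) (by omega), varExp_apply (by omega) (by omega),
      varExp_apply (by omega) (by omega), if_pos rfl, if_neg (by omega),
      if_neg (by omega)] at hlast
    omega
  · refine absurd ?_ (not_varExp_add_le hp h2 h3 (t := c.u + i') (b := 0))
    rw [zero_smul, add_zero]
    exact h
  · exact absurd h (not_varExp_add_le hp h2 h3)
  · refine absurd ?_ (not_varExp_add_le hp h2 h3 (t := 0) (b := c.v))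
    rw [gExp_zero, zero_add]
    exact h
  · obtain ⟨rfl, rfl⟩ := varExp_add_le_inj h2 h3 h2' h3' h
    rfl

end Basis

end AlmostArith

theorem theorem3p2 (K : Type*) [Field K] (p : ℕ) (m : Fin (p + 2) → ℕ)
    (hm : AlmostArith.IsAlmostArith m) :
    (∃! c : AlmostArith.Params, AlmostArith.IsParams m c) ∧
    ∀ c : AlmostArith.Params, AlmostArith.IsParams m c →
      AlmostArith.IsMinimalGroebnerBasis (AlmostArith.wGrevlex m hm.pos)
        (AlmostArith.curveIdeal K m) (AlmostArith.Phi K p c) := by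
  refine ⟨?_, fun c hc => ?_⟩
  · obtain ⟨c, hc⟩ := AlmostArith.exists_isParams hm
    exact ⟨c, hc, fun c' hc' => hc'.ext hm hc⟩
  · rw [← AlmostArith.binomial_PhiPairs K hm.one_le_p hc.z_lt hc.w_lt]
    exact AlmostArith.isMinimalGroebnerBasis_binomial hm.pos (AlmostArith.PhiPairs_finite c)
      (fun _ hd => AlmostArith.PhiPairs_wt hm hc hd) (fun _ hd => AlmostArith.PhiPairs_lt hm hc hd)
      (fun _ _ hf hf' h => AlmostArith.normal_form_unique hm hc hf hf' h)
      (fun _ hd _ hd' h => AlmostArith.PhiPairs_antichain hm hc hd hd' h)
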